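/- Let $F$ belong to the extended Selberg class $\mathcal S^\sharp$. That is: (S1) $F(s)=\sum_{n\ge1}a_F(n)n^{-s}$ with absolute convergence for $\Re(s)>1$; (S2) there is an integer $m\ge 0$ such that $(s-1)^mF(s)$ extends to an entire function of finite order, and $m_F$ denotes the smallest such $m$; (S3) there are $r\ge0$, $Q>0$, $\lambda_j>0$, $\mu_j\in\mathbb C$ with $\Re(\mu_j)\ge0$ $(1\le j\le r)$ and $\omega\in\mathbb C$ with $|\omega|=1$ such that $$\xi_F(s):=s^{m_F}(s-1)^{m_F}Q^s\prod_{j=1}^r\Gamma(\lambda_js+\mu_j)\,F(s)\quad\text{satisfies}\quad \xi_F(s)=\omega\,\overline{\xi_F(1-\bar s)},$$ where $\xi_F$ denotes the meromorphic (in fact entire) function on $\mathbb C$ given by this product, its removable singularities being filled in. Fix any such parameters. The zeros of $\xi_F$ are called the nontrivial zeros of $F$, and the Grand Riemann Hypothesis (GRH) for $F$ is the assertion that they all lie on the line $\Re(s)=1/2$. Let $\Gamma_F^\sharp$ be the set of zeros of $z\mapsto\xi_F(1/2-iz)$, let $m_\gamma$ be the multiplicity of the zero $\gamma$, and let $m_0$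 be the multiplicity at $0$ ($m_0=0$ if $0\notin\Gamma_F^\sharp$). Let $iB_F=\lim_{s\to1/2}\bigl(\frac{\xi_F'}{\xi_F}(s)-\frac{m_0}{s-1/2}\bigr)$, which is $\frac{\xi_F'}{\xi_F}(1/2)$ if $\xi_F(1/2)\ne0$. Put $$g_F(t)=-iB_F\,t-\frac{m_0}{2}t^2+\sum_{\gamma\in\Gamma_F^\sharp\setminus\{0\}}m_\gamma\frac{e^{-i\gamma t}-1}{\gamma^2}\quad(t\ge0),\qquad g_F(t)=\overline{g_F(-t)}\quad(t<0).$$ Assume that $F$ has no real nontrivial zero (real zero of $\xi_F$) except possibly $s=1/2$. Then the series over $\gamma$ converges absolutely for every real $t$, and the GRH for $F$ is true if and only if there is $t_0\ge0$ such that $\Re(-g_F(t))\ge0$ for all $t\ge t_0$. -/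

import Mathlib

open scoped ComplexConjugate Topology

noncomputable section

namespace ExtSelberg

/-- An entire function of finite order: `|G(s)| ≤ C exp(|s|^ρ)` for some real `ρ`, `C`. -/
def IsEntireOfFiniteOrder (G : ℂ → ℂ) : Prop :=
  Differentiable ℂ G ∧ ∃ ρ C : ℝ, ∀ s : ℂ, ‖G s‖ ≤ C * Real.exp (‖s‖ ^ ρ)

/-- On `Re s > 1` the function `F` is given by an absolutely convergent Dirichlet series. -/
def HasDirichletSeries (F : ℂ → ℂ) : Prop :=
  ∃ a : ℕ → ℂ, ∀ s : ℂ, 1 < s.re → LSeriesSummable a s ∧ F s = LSeries a s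

/-- `(s - 1)^m F(s)` extends to an entire function of finite order.
The value `F 1` (where `F` may have a pole) plays no role. -/
def PoleCancelledBy (F : ℂ → ℂ) (m : ℕ) : Prop :=
  ∃ G : ℂ → ℂ, IsEntireOfFiniteOrder G ∧ ∀ s : ℂ, s ≠ 1 → G s = (s - 1) ^ m * F s

/-- The smallest `m` such that `(s - 1)^m F(s)` extends to an entire function of finite order. -/
def polarOrder (F : ℂ → ℂ) : ℕ := sInf {m : ℕ | PoleCancelledBy F m}

/-- The parameters `(ω, Q, r, λ_j, μ_j)` of a functional equation. -/
structure FEData where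
  r : ℕ
  Q : ℝ
  lam : Fin r → ℝ
  mu : Fin r → ℂ
  omega : ℂ
  Q_pos : 0 < Q
  lam_pos : ∀ j, 0 < lam j
  mu_re_nonneg : ∀ j, 0 ≤ (mu j).re
  norm_omega : ‖omega‖ = 1

/-- The gamma factor `Q^s ∏ Γ(λ_j s + μ_j)`. -/
def FEData.gammaFactor (D : FEData) (s : ℂ) : ℂ :=
  (D.Q : ℂ) ^ s * ∏ j, Complex.Gamma (D.lam j * s + D.mu j)

/-- The completed function `ξ_F(s) = s^{m_F} (s-1)^{m_F} γ(s) F(s)` as a meromorphic function on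
`ℂ`: the product is put into normal form, i.e. at its removable singularities (`s = 1` and the
poles of the gamma factor) the value is the limit. -/
def xi (D : FEData) (F : ℂ → ℂ) : ℂ → ℂ :=
  toMeromorphicNFOn
    (fun s => s ^ polarOrder F * (s - 1) ^ polarOrder F * D.gammaFactor s * F s) Set.univ

/-- The functional equation of `F` with the parameters `D`. -/
def SatisfiesFE (D : FEData) (F : ℂ → ℂ) : Prop :=
  ∀ s : ℂ, xi D F s = D.omega * conj (xi D F (1 - conj s))

/-- The extended Selberg class. -/
def ExtendedSelbergClass : Set (ℂ → ℂ) :=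
  {F | HasDirichletSeries F ∧ (∃ m, PoleCancelledBy F m) ∧ ∃ D : FEData, SatisfiesFE D F}

/-- The Grand Riemann Hypothesis for `F`: all zeros of `ξ_F` lie on `Re s = 1/2`. -/
def GRH (D : FEData) (F : ℂ → ℂ) : Prop :=
  ∀ s : ℂ, xi D F s = 0 → s.re = 1 / 2

/-- The set of nontrivial zeros of `F(1/2 - iz)`. -/
def nontrivialZeros (D : FEData) (F : ℂ → ℂ) : Set ℂ :=
  {γ | xi D F (1 / 2 - Complex.I * γ) = 0}

/-- The multiplicity of `γ` as a zero of `ξ_F(1/2 - iz)`; it is `0` if `γ` is not a zero. -/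
def zeroMult (D : FEData) (F : ℂ → ℂ) (γ : ℂ) : ℕ :=
  analyticOrderNatAt (fun z => xi D F (1 / 2 - Complex.I * z)) γ

/-- The constant `i B_F`, i.e. the constant term of the Laurent expansion of `ξ_F'/ξ_F` at `1/2`.
It is `(ξ_F'/ξ_F)(1/2)` if `ξ_F(1/2) ≠ 0`; if `1/2` is a zero of order `m_0`, the polar part
`m_0 / (s - 1/2)` is removed first. -/
def iB (D : FEData) (F : ℂ → ℂ) : ℂ :=
  Filter.limUnder (𝓝[≠] (1 / 2 : ℂ))
    (fun s => logDeriv (xi D F) s - (zeroMult D F 0 : ℂ) / (s - 1 / 2))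

/-- The term of the zero `γ` in the series defining the screw function. -/
def screwTerm (D : FEData) (F : ℂ → ℂ) (t : ℝ) (γ : ℂ) : ℂ :=
  (zeroMult D F γ : ℂ) * ((Complex.exp (-Complex.I * γ * t) - 1) / γ ^ 2)

/-- The formula for the screw function at nonnegative `t`. -/
def screwFormula (D : FEData) (F : ℂ → ℂ) (t : ℝ) : ℂ :=
  -iB D F * t - (zeroMult D F 0 : ℂ) / 2 * (t : ℂ) ^ 2
    + ∑' γ : ↥(nontrivialZeros D F \ {0}), screwTerm D F t γ

/-- The screw function `g_F`. -/
def screw (D : FEData) (F : ℂ → ℂ) (t : ℝ) : ℂ :=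
  if 0 ≤ t then screwFormula D F t else conj (screwFormula D F (-t))

end ExtSelberg

end

/-! Write the zeros of `xi` as `1/2 + p` with `p = -iγ`. Up to a constant and `(m_0/2) t²`,
`Re(-g_F(t))` is the real part of `∑ c_γ e^{p t}` with `c_γ = m_γ / p²`; the linear term drops out
because the functional equation forces `Re(iB_F) = 0` (`iB_re`).

Convergence: `xi` is entire and `O(exp(C|s|^{3/2}))` (`xi_expGrowth`), so Jensen's inequality gives
`O(R^{3/2})` zeros in a disc of radius `R` and `∑ m_γ/|γ|²` converges. All zeros lie in a vertical
strip (`xi_zeros_in_strip`), so each exponential is at most `e^{A|t|}`.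

If GRH holds, every `γ` is real and each term contributes `m_γ (1 - cos γt)/γ² ≥ 0`.

Conversely, adding a constant makes an eventually nonnegative `Re(-g_F)` nonnegative on all of `t >
0`. Its Laplace transform continues to `Re w > 0` with possible poles only at the points `p` and
their conjugates, none of them a positive real since `xi` has no real zero other than `1/2`. By
Landau's theorem (`Ioi_subset_integrableExpSet_of_analyticAt`) the Laplace integral converges, and
is analytic, for `Re w > 0`. So the residue at a pole `q` with `Re q > 0`, chosen rightmost on its
horizontal line, must vanish (`tsum_residue_eq_zero`). That residue is a positive combination of
multiplicities divided by `q²`, a contradiction. Hence no zero has `Re s > 1/2`, and the functional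
equation excludes `Re s < 1/2`. -/

namespace ExtSelberg
open Complex Filter

/-! ### Entireness of the completed function -/

/-- The product defining `ξ_F`, before its removable singularities are filled in. -/
noncomputable def rawXi (D : FEData) (F : ℂ → ℂ) (s : ℂ) : ℂ :=
  s ^ polarOrder F * (s - 1) ^ polarOrder F * D.gammaFactor s * F s

lemma exists_entire_of_mem (F : ℂ → ℂ) (hF : F ∈ ExtendedSelbergClass) :
    PoleCancelledBy F (polarOrder F) :=
  Nat.sInf_mem (s := {m : ℕ | PoleCancelledBy F m}) hF.2.1

lemma FEData.meromorphic_gammaFactor (D : FEData) : Meromorphic D.gammaFactor := by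
  intro s
  have h1 : AnalyticAt ℂ (fun s : ℂ => (D.Q : ℂ) ^ s) s := by
    have : Differentiable ℂ (fun s : ℂ => (D.Q : ℂ) ^ s) := fun s =>
      (differentiableAt_id).const_cpow (Or.inl (by exact_mod_cast D.Q_pos.ne'))
    exact this.analyticAt s
  refine h1.meromorphicAt.mul ?_
  refine MeromorphicAt.fun_prod fun j _ => ?_
  have h2 : MeromorphicAt Gamma ((fun s : ℂ => D.lam j * s + D.mu j) s) := Meromorphic.Gamma _
  have h3 : AnalyticAt ℂ (fun s : ℂ => D.lam j * s + D.mu j) s := by fun_prop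
  exact MeromorphicAt.comp_analyticAt (f := Gamma) (g := fun s : ℂ => D.lam j * s + D.mu j) h2 h3

lemma FEData.re_arg_pos (D : FEData) {s : ℂ} (hs : 0 < s.re) (j : Fin D.r) :
    0 < ((D.lam j : ℂ) * s + D.mu j).re := by
  have h1 := mul_pos (D.lam_pos j) hs
  have h2 := D.mu_re_nonneg j
  simp
  linarith

lemma FEData.differentiableAt_gammaFactor (D : FEData) {s : ℂ} (hs : 0 < s.re) :
    DifferentiableAt ℂ D.gammaFactor s := by
  unfold FEData.gammaFactor
  refine DifferentiableAt.mul ((differentiableAt_id).const_cpow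
    (Or.inl (by exact_mod_cast D.Q_pos.ne'))) ?_
  refine DifferentiableAt.fun_finsetProd fun j _ => ?_
  refine DifferentiableAt.comp s (g := Gamma) ?_ (by fun_prop)
  refine differentiableAt_Gamma _ fun m h => ?_
  have := D.re_arg_pos hs j
  rw [h] at this
  simp at this
  linarith [(Nat.cast_nonneg m : (0 : ℝ) ≤ m)]

lemma FEData.gammaFactor_ne_zero (D : FEData) {s : ℂ} (hs : 0 < s.re) :
    D.gammaFactor s ≠ 0 := by
  refine mul_ne_zero ?_ (Finset.prod_ne_zero_iff.2 fun j _ => ?_)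
  · rw [cpow_def_of_ne_zero (by exact_mod_cast D.Q_pos.ne')]
    exact exp_ne_zero _
  · exact Gamma_ne_zero_of_re_pos (D.re_arg_pos hs j)

section

variable {D : FEData} {F G : ℂ → ℂ}

lemma meromorphic_rawXi (hG : Differentiable ℂ G)
    (hGF : ∀ s : ℂ, s ≠ 1 → G s = (s - 1) ^ polarOrder F * F s) :
    Meromorphic (rawXi D F) := by
  intro s
  have h : MeromorphicAt (fun s : ℂ => s ^ polarOrder F * D.gammaFactor s * G s) s :=
    (MeromorphicAt.mul (by fun_prop) (D.meromorphic_gammaFactor s)).mul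
      (hG.analyticAt s).meromorphicAt
  refine h.congr ?_
  have h1 : ∀ᶠ z in 𝓝[≠] s, z ≠ 1 := by
    rcases eq_or_ne s 1 with rfl | hs
    · exact eventually_mem_nhdsWithin
    · exact eventually_nhdsWithin_of_eventually_nhds (eventually_ne_nhds hs)
  filter_upwards [h1] with z hz
  rw [hGF z hz, rawXi]
  ring

/-- Only a punctured statement is possible at this stage: `F 1` is an arbitrary value and the gamma
factor has poles in `Re s ≤ 0`. -/
lemma xi_eventuallyEq_punctured (hG : Differentiable ℂ G)
    (hGF : ∀ s : ℂ, s ≠ 1 → G s = (s - 1) ^ polarOrder F * F s) (s : ℂ) :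
    xi D F =ᶠ[𝓝[≠] s] fun s => s ^ polarOrder F * D.gammaFactor s * G s := by
  have h1 : ∀ᶠ z in 𝓝[≠] s, z ≠ 1 := by
    rcases eq_or_ne s 1 with rfl | hs
    · exact eventually_mem_nhdsWithin
    · exact eventually_nhdsWithin_of_eventually_nhds (eventually_ne_nhds hs)
  have hm : MeromorphicOn (rawXi D F) Set.univ := fun s _ => meromorphic_rawXi hG hGF s
  filter_upwards [h1, hm.toMeromorphicNFOn_eq_self_on_nhdsNE (Set.mem_univ s)] with z hz hz'
  rw [hGF z hz]
  refine Eq.trans hz' ?_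
  rw [rawXi]
  ring

/-- For `Re s > 0` the gamma factor has no poles, so the product with `G` is analytic. Two functions
in meromorphic normal form that agree off a point also agree at it. -/
lemma xi_analyticAt_of_re_pos (hG : Differentiable ℂ G)
    (hGF : ∀ s : ℂ, s ≠ 1 → G s = (s - 1) ^ polarOrder F * F s) {s : ℂ} (hs : 0 < s.re) :
    AnalyticAt ℂ (xi D F) s ∧ xi D F s = s ^ polarOrder F * D.gammaFactor s * G s := by
  have hd : DifferentiableOn ℂ (fun s => s ^ polarOrder F * D.gammaFactor s * G s)
      {s | 0 < s.re} := fun z hz =>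
    ((DifferentiableAt.mul (by fun_prop) (D.differentiableAt_gammaFactor hz)).mul
      (hG z)).differentiableWithinAt
  have ha : AnalyticAt ℂ (fun s => s ^ polarOrder F * D.gammaFactor s * G s) s :=
    hd.analyticAt ((isOpen_lt continuous_const continuous_re).mem_nhds hs)
  have hnf : MeromorphicNFAt (xi D F) s :=
    meromorphicNFOn_toMeromorphicNFOn _ _ (Set.mem_univ s)
  have h := (hnf.eventuallyEq_nhdsNE_iff_eventuallyEq_nhds ha.meromorphicNFAt).1
    (xi_eventuallyEq_punctured hG hGF s)
  exact ⟨ha.congr h.symm, h.eq_of_nhds⟩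

/-- The half-plane `Re s ≤ 0` is reached by reflection: `1 - conj s` has real part at least `1`, and
`conj ∘ f ∘ conj` is holomorphic when `f` is. -/
lemma xi_differentiable (hD : SatisfiesFE D F) (hG : Differentiable ℂ G)
    (hGF : ∀ s : ℂ, s ≠ 1 → G s = (s - 1) ^ polarOrder F * F s) :
    Differentiable ℂ (xi D F) := by
  intro s
  rcases lt_or_ge 0 s.re with hs | hs
  · exact (xi_analyticAt_of_re_pos hG hGF hs).1.differentiableAt
  · have h1 : DifferentiableAt ℂ (xi D F) (1 - conj s) :=
      (xi_analyticAt_of_re_pos hG hGF (by simp; linarith)).1.differentiableAt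
    have h2 : DifferentiableAt ℂ (fun z => xi D F (1 - z)) (conj s) :=
      DifferentiableAt.comp (conj s) h1 (by fun_prop)
    have h3 := h2.conj_conj
    rw [conj_conj] at h3
    have h4 : xi D F = fun z => D.omega * (conj ∘ (fun z => xi D F (1 - z)) ∘ conj) z :=
      funext fun z => hD z
    rw [h4]
    exact h3.const_mul _

lemma norm_xi_reflect (hD : SatisfiesFE D F) (s : ℂ) : ‖xi D F s‖ = ‖xi D F (1 - conj s)‖ := by
  conv_lhs => rw [hD s]
  rw [norm_mul, D.norm_omega, one_mul, norm_conj]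

end

end ExtSelberg

/-! ### Growth of the gamma factor; zero-free half-plane of the Dirichlet series -/

namespace ExtSelberg
open Complex Filter

/-- `f` grows at most like `exp (C |s|^k)` on `S`. -/
def ExpGrowth (S : Set ℂ) (k : ℝ) (f : ℂ → ℂ) : Prop :=
  ∃ C : ℝ, 0 ≤ C ∧ ∀ s ∈ S, ‖f s‖ ≤ Real.exp (C * (1 + ‖s‖) ^ k)

namespace ExpGrowth

variable {S T : Set ℂ} {k l : ℝ} {f g : ℂ → ℂ}

lemma one_le_rpow (hk : 0 ≤ k) (s : ℂ) : 1 ≤ (1 + ‖s‖) ^ k :=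
  Real.one_le_rpow (by linarith [norm_nonneg s]) hk

lemma of_bound (hk : 0 ≤ k) {K : ℝ} (h : ∀ s ∈ S, ‖f s‖ ≤ K) : ExpGrowth S k f := by
  refine ⟨|K|, abs_nonneg _, fun s hs => (h s hs).trans ?_⟩
  have h1 : |K| ≤ |K| * (1 + ‖s‖) ^ k := le_mul_of_one_le_right (abs_nonneg _) (one_le_rpow hk s)
  linarith [Real.add_one_le_exp (|K| * (1 + ‖s‖) ^ k), le_abs_self K]

lemma mul (hf : ExpGrowth S k f) (hg : ExpGrowth S k g) :
    ExpGrowth S k (fun s => f s * g s) := by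
  obtain ⟨C, hC, hf⟩ := hf
  obtain ⟨B, hB, hg⟩ := hg
  refine ⟨C + B, by positivity, fun s hs => ?_⟩
  rw [norm_mul, add_mul, Real.exp_add]
  exact mul_le_mul (hf s hs) (hg s hs) (norm_nonneg _) (Real.exp_nonneg _)

lemma prod {ι : Type*} (u : Finset ι) {f : ι → ℂ → ℂ} (hk : 0 ≤ k)
    (hf : ∀ i ∈ u, ExpGrowth S k (f i)) : ExpGrowth S k (fun s => ∏ i ∈ u, f i s) := by
  classical
  induction u using Finset.induction_on with
  | empty => exact of_bound hk (K := 1) (fun s _ => by simp)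
  | insert i u hi ih =>
    simp only [Finset.prod_insert hi]
    exact (hf i (by simp)).mul (ih fun j hj => hf j (by simp [hj]))

lemma pow (hk : 0 ≤ k) (hf : ExpGrowth S k f) (n : ℕ) : ExpGrowth S k (fun s => f s ^ n) := by
  simpa using prod (Finset.range n) hk (f := fun _ => f) (fun _ _ => hf)

lemma mono_set (hf : ExpGrowth S k f) (h : T ⊆ S) : ExpGrowth T k f := by
  obtain ⟨C, hC, hf⟩ := hf
  exact ⟨C, hC, fun s hs => hf s (h hs)⟩

lemma mono_exponent (hf : ExpGrowth S k f) (h : k ≤ l) : ExpGrowth S l f := by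
  obtain ⟨C, hC, hf⟩ := hf
  refine ⟨C, hC, fun s hs => (hf s hs).trans ?_⟩
  gcongr
  linarith [norm_nonneg s]

lemma of_linear (hk : 1 ≤ k) {A : ℝ} (h : ∀ s ∈ S, ‖f s‖ ≤ A * (1 + ‖s‖)) :
    ExpGrowth S k f := by
  refine ExpGrowth.mono_exponent (k := 1) ⟨|A|, abs_nonneg _, fun s hs => (h s hs).trans ?_⟩ hk
  rw [Real.rpow_one]
  have h1 : A * (1 + ‖s‖) ≤ |A| * (1 + ‖s‖) := by
    gcongr
    exact le_abs_self A
  linarith [Real.add_one_le_exp (|A| * (1 + ‖s‖))]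

lemma union (hf : ExpGrowth S k f) (hg : ExpGrowth T k f) : ExpGrowth (S ∪ T) k f := by
  obtain ⟨C, hC, hf⟩ := hf
  obtain ⟨B, hB, hg⟩ := hg
  refine ⟨C + B, by positivity, fun s hs => ?_⟩
  have h0 : 0 ≤ (1 + ‖s‖) ^ k := Real.rpow_nonneg (by positivity) _
  rcases hs with hs | hs
  · refine (hf s hs).trans ?_
    gcongr
    linarith
  · refine (hg s hs).trans ?_
    gcongr
    linarith

lemma reflect (hk : 0 ≤ k) (hf : ExpGrowth S k f) (h : ∀ s, ‖f s‖ = ‖f (1 - conj s)‖) :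
    ExpGrowth {s | 1 - conj s ∈ S} k f := by
  obtain ⟨C, hC, hf⟩ := hf
  refine ⟨C * 2 ^ k, by positivity, fun s hs => ?_⟩
  rw [h]
  refine (hf _ hs).trans ?_
  rw [mul_assoc, ← Real.mul_rpow (by norm_num) (by positivity)]
  gcongr
  have := norm_sub_le (1 : ℂ) (conj s)
  rw [norm_conj, norm_one] at this
  linarith [norm_nonneg s]

end ExpGrowth

lemma norm_Gamma_le_Gamma_re {s : ℂ} (hs : 0 < s.re) : ‖Gamma s‖ ≤ Real.Gamma s.re := by
  rw [Gamma_eq_integral hs, Real.Gamma_eq_integral hs, GammaIntegral]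
  refine (MeasureTheory.norm_integral_le_integral_norm _).trans_eq ?_
  refine MeasureTheory.setIntegral_congr_fun measurableSet_Ioi fun x hx => ?_
  have hx' : (0 : ℝ) < x := hx
  simp only [norm_mul, norm_cpow_eq_rpow_re_of_pos hx', sub_re, one_re]
  rw [norm_real, Real.norm_eq_abs, Real.abs_exp]

/-- Stirling gives `exp(O(x log x))`; the exponent `3/2` absorbs the logarithm and stays below `2`,
which is what convergence of `∑ m_γ/|γ|²` needs. -/
lemma exists_Gamma_le_exp {x₀ : ℝ} (hx₀ : 0 < x₀) :
    ∃ C : ℝ, 0 ≤ C ∧ ∀ x, x₀ ≤ x → Real.Gamma x ≤ Real.exp (C * (1 + x) ^ (3 / 2 : ℝ)) := by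
  -- The shift by `2` moves the argument to where Gamma is increasing, so that `Γ(x+2) ≤ n! ≤ n^n`.
  -- It is undone below by dividing by `x(x+1) ≥ x₀²`.
  have key : ∀ x : ℝ, 0 < x →
      Real.Gamma (x + 2) ≤ Real.exp (2 * 3 ^ (3 / 2 : ℝ) * (1 + x) ^ (3 / 2 : ℝ)) := by
    intro x hx
    set n := ⌈x + 2⌉₊
    have hn1 : x + 2 ≤ n := Nat.le_ceil _
    have hn2 : (n : ℝ) < x + 2 + 1 := Nat.ceil_lt_add_one (by linarith)
    have hn0 : (0 : ℝ) < n := by linarith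
    have h1 : Real.Gamma (x + 2) ≤ Real.Gamma (n + 1) :=
      Real.Gamma_strictMonoOn_Ici.monotoneOn (by simp; linarith) (by simp; linarith) (by linarith)
    rw [Real.Gamma_nat_eq_factorial] at h1
    have h2 : (n.factorial : ℝ) ≤ (n : ℝ) ^ n := by exact_mod_cast Nat.factorial_le_pow n
    have h3 : (n : ℝ) ^ n = Real.exp (n * Real.log n) := by
      rw [mul_comm, Real.exp_mul, Real.exp_log hn0, Real.rpow_natCast]
    have h4 : Real.log n ≤ (n : ℝ) ^ (1 / 2 : ℝ) / (1 / 2) :=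
      Real.log_le_rpow_div hn0.le (by norm_num)
    have h5 : (n : ℝ) * Real.log n ≤ 2 * (n : ℝ) ^ (3 / 2 : ℝ) := by
      have : (n : ℝ) ^ (3 / 2 : ℝ) = n * (n : ℝ) ^ (1 / 2 : ℝ) := by
        rw [show (3 / 2 : ℝ) = 1 + 1 / 2 by norm_num, Real.rpow_add hn0, Real.rpow_one]
      rw [this]
      nlinarith
    have h6 : (n : ℝ) ^ (3 / 2 : ℝ) ≤ 3 ^ (3 / 2 : ℝ) * (1 + x) ^ (3 / 2 : ℝ) := by
      rw [← Real.mul_rpow (by norm_num) (by linarith)]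
      gcongr
      linarith
    refine h1.trans (h2.trans (h3.le.trans (Real.exp_le_exp.2 ?_)))
    linarith
  refine ⟨2 * 3 ^ (3 / 2 : ℝ) + 1 / (x₀ * x₀), by positivity, fun x hx => ?_⟩
  have hx' : 0 < x := hx₀.trans_le hx
  have h1 : Real.Gamma (x + 2) = (x + 1) * (x * Real.Gamma x) := by
    rw [show x + 2 = x + 1 + 1 by ring, Real.Gamma_add_one (by linarith),
      Real.Gamma_add_one hx'.ne']
  have h2 : Real.Gamma x ≤ 1 / (x₀ * x₀) * Real.Gamma (x + 2) := by
    rw [h1, one_div, ← div_eq_inv_mul, le_div_iff₀ (by positivity)]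
    have : 0 < Real.Gamma x := Real.Gamma_pos_of_pos hx'
    have h3 : x₀ * x₀ ≤ (x + 1) * x := by nlinarith
    nlinarith
  have hone : 1 ≤ (1 + x) ^ (3 / 2 : ℝ) := Real.one_le_rpow (by linarith) (by norm_num)
  have h3 : 1 / (x₀ * x₀) ≤ Real.exp (1 / (x₀ * x₀) * (1 + x) ^ (3 / 2 : ℝ)) := by
    have : 1 / (x₀ * x₀) ≤ 1 / (x₀ * x₀) * (1 + x) ^ (3 / 2 : ℝ) :=
      le_mul_of_one_le_right (by positivity) hone
    linarith [Real.add_one_le_exp (1 / (x₀ * x₀) * (1 + x) ^ (3 / 2 : ℝ))]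
  rw [add_mul, Real.exp_add, mul_comm (Real.exp _)]
  exact h2.trans (mul_le_mul h3 (key x hx') (Real.Gamma_pos_of_pos (by linarith)).le
    (Real.exp_nonneg _))

lemma FEData.norm_Q_cpow (D : FEData) (s : ℂ) : ‖(D.Q : ℂ) ^ s‖ = D.Q ^ s.re :=
  norm_cpow_eq_rpow_re_of_pos D.Q_pos s

lemma FEData.expGrowth_gammaFactor (D : FEData) :
    ExpGrowth {s | 1 / 2 ≤ s.re} (3 / 2) D.gammaFactor := by
  refine ExpGrowth.mul ?_ (ExpGrowth.prod _ (by norm_num) fun j _ => ?_)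
  · refine ExpGrowth.mono_exponent (k := 1) ⟨|Real.log D.Q|, abs_nonneg _, fun s _ => ?_⟩
      (by norm_num)
    rw [D.norm_Q_cpow, Real.rpow_def_of_pos D.Q_pos, Real.rpow_one]
    refine Real.exp_le_exp.2 ((le_abs_self _).trans ?_)
    rw [abs_mul]
    gcongr
    linarith [abs_re_le_norm s]
  · obtain ⟨C, hC, h⟩ := exists_Gamma_le_exp (x₀ := D.lam j / 2) (by linarith [D.lam_pos j])
    have hl := D.lam_pos j
    refine ⟨C * (1 + D.lam j + ‖D.mu j‖) ^ (3 / 2 : ℝ), by positivity, fun s hs => ?_⟩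
    have hs' : 1 / 2 ≤ s.re := hs
    have h0 := D.re_arg_pos (s := s) (by linarith) j
    have hre : ((D.lam j : ℂ) * s + D.mu j).re = D.lam j * s.re + (D.mu j).re := by simp
    have hmu := D.mu_re_nonneg j
    refine (norm_Gamma_le_Gamma_re h0).trans ((h _ ?_).trans ?_)
    · rw [hre]; nlinarith
    · rw [mul_assoc, ← Real.mul_rpow (by positivity) (by positivity)]
      gcongr
      rw [hre]
      have h1 := (le_abs_self _).trans (abs_re_le_norm s)
      have h2 := (le_abs_self _).trans (abs_re_le_norm (D.mu j))
      have h3 : D.lam j * s.re ≤ D.lam j * ‖s‖ := by gcongr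
      nlinarith [norm_nonneg s, norm_nonneg (D.mu j), mul_nonneg (norm_nonneg s) (norm_nonneg (D.mu j))]

lemma FEData.gammaFactor_bounded_on_line (D : FEData) :
    ∃ K : ℝ, ∀ s : ℂ, s.re = 2 → ‖D.gammaFactor s‖ ≤ K := by
  refine ⟨D.Q ^ (2 : ℝ) * ∏ j, Real.Gamma (D.lam j * 2 + (D.mu j).re), fun s hs => ?_⟩
  rw [FEData.gammaFactor, norm_mul, D.norm_Q_cpow, hs, norm_prod]
  have := D.Q_pos
  gcongr with j
  have h := norm_Gamma_le_Gamma_re (D.re_arg_pos (s := s) (by rw [hs]; norm_num) j)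
  simpa [hs] using h

section

variable {D : FEData} {F G : ℂ → ℂ}

lemma dirichlet_bounded (hF : HasDirichletSeries F) :
    ∃ K : ℝ, 0 ≤ K ∧ ∀ s : ℂ, 2 ≤ s.re → ‖F s‖ ≤ K := by
  obtain ⟨a, ha⟩ := hF
  have h2 : LSeriesSummable a 2 := (ha 2 (by norm_num)).1
  refine ⟨∑' n, ‖LSeries.term a 2 n‖, tsum_nonneg fun _ => norm_nonneg _, fun s hs => ?_⟩
  rw [(ha s (by linarith)).2]
  exact tsum_of_norm_bounded h2.norm.hasSum fun n =>
    LSeries.norm_term_le_of_re_le_re a (by simpa using hs) n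

/-- The first nonzero coefficient dominates far to the right: the later terms are majorised by the
series of `‖a n‖` at the real point `Re s`, which is `o((N+1)^{-Re s})`. -/
lemma exists_zero_free_half_plane (hF : HasDirichletSeries F) (h2 : F 2 ≠ 0) :
    ∃ A : ℝ, 1 < A ∧ ∀ s : ℂ, A ≤ s.re → F s ≠ 0 := by
  classical
  obtain ⟨a, ha⟩ := hF
  have hex : ∃ n : ℕ, a (n + 1) ≠ 0 := by
    by_contra! h
    apply h2
    rw [(ha 2 (by norm_num)).2]
    refine (tsum_congr fun n => ?_).trans tsum_zero
    rcases n with _ | n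
    · simp
    · simp [LSeries.term, h n]
  set N := Nat.find hex
  have hN : a (N + 1) ≠ 0 := Nat.find_spec hex
  have hlt : ∀ m, m < N → a (m + 1) = 0 := fun m hm => by
    simpa using Nat.find_min hex hm
  -- Absolute values of the coefficients strictly after the leading index `N + 1`. As `b (N + 1) =
  -- 0`, the limit of `(N+1)^x` times its L-series is `0`.
  let b : ℕ → ℂ := fun n => if n ≤ N + 1 then 0 else ((‖a n‖ : ℝ) : ℂ)
  have hb_le : ∀ n, ‖b n‖ ≤ ‖a n‖ := fun n => by
    by_cases h : n ≤ N + 1 <;> simp [b, h]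
  have hbs : ∀ x : ℝ, 1 < x → LSeriesSummable b x := fun x hx =>
    Summable.of_norm_bounded (ha x (by simpa using hx)).1.norm fun n =>
      LSeries.norm_term_le _ (hb_le n)
  have hlim := LSeries.tendsto_cpow_mul_atTop (f := b) (n := N)
    (fun m hm => by simp [b, Nat.le_succ_of_le hm])
    ((LSeriesSummable.abscissaOfAbsConv_le (hbs 2 (by norm_num))).trans_lt (EReal.coe_lt_top _))
  have hb0 : b (N + 1) = 0 := by simp [b]
  rw [hb0] at hlim
  have hev := hlim.norm.eventually_lt_const (u := ‖a (N + 1)‖) (by simpa using hN)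
  obtain ⟨A, hA⟩ := eventually_atTop.1 hev
  refine ⟨max A 2, lt_max_of_lt_right (by norm_num), fun s hs h0 => ?_⟩
  have hs1 : 1 < s.re := by linarith [le_max_right A 2]
  have hk := hA s.re ((le_max_left _ _).trans hs)
  have hNn : (0 : ℝ) < N + 1 := by positivity
  have hNc : ‖((N : ℂ) + 1) ^ (s.re : ℂ)‖ = ((N : ℝ) + 1) ^ s.re := by
    have := norm_cpow_eq_rpow_re_of_pos hNn (s.re : ℂ)
    simpa using this
  rw [norm_mul, hNc] at hk
  have hterm : ∀ n, LSeries.term b s.re n = ((‖LSeries.term b s.re n‖ : ℝ) : ℂ) := by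
    intro n
    rcases Nat.eq_zero_or_pos n with rfl | hn
    · simp
    · rw [LSeries.norm_term_eq, LSeries.term_of_ne_zero hn.ne', if_neg hn.ne']
      by_cases h : n ≤ N + 1
      · simp [b, h]
      · simp only [b, h, if_false, norm_real, norm_norm, ofReal_div, ofReal_re]
        rw [ofReal_cpow (Nat.cast_nonneg n)]
        simp
  have hL : ‖LSeries b s.re‖ = ∑' n, ‖LSeries.term b s.re n‖ := by
    rw [LSeries, tsum_congr hterm, ← ofReal_tsum, norm_real, Real.norm_eq_abs,
      abs_of_nonneg (tsum_nonneg fun _ => norm_nonneg _)]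
  have hsplit := (ha s hs1).1.tsum_eq_add_tsum_ite (N + 1)
  rw [← LSeries, ← (ha s hs1).2, h0] at hsplit
  have hrest : ‖∑' n, ite (n = N + 1) 0 (LSeries.term a s n)‖ ≤
      ∑' n, ‖LSeries.term b s.re n‖ := by
    refine tsum_of_norm_bounded (hbs s.re hs1).norm.hasSum fun n => ?_
    rcases lt_trichotomy n (N + 1) with h | h | h
    · rcases n with _ | n
      · simp
      · have : a (n + 1) = 0 := hlt n (by omega)
        simpa [LSeries.term, this] using by positivity
    · simpa [h] using by positivity
    · rw [if_neg h.ne', LSeries.norm_term_eq, LSeries.norm_term_eq]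
      simp [b, not_le.2 h]
  have hlead : ‖LSeries.term a s (N + 1)‖ = ‖a (N + 1)‖ / ((N : ℝ) + 1) ^ s.re := by
    rw [LSeries.norm_term_eq]
    simp
  have hle : ‖LSeries.term a s (N + 1)‖ ≤ ‖LSeries b s.re‖ := by
    rw [eq_neg_of_add_eq_zero_left hsplit.symm, norm_neg, hL]
    exact hrest
  rw [hlead, div_le_iff₀ (by positivity)] at hle
  linarith

end

end ExtSelberg

/-! ### Order of `xi` at most 3/2 and the strip of zeros -/

namespace ExtSelberg
open Complex Filter

section

variable {D : FEData} {F G : ℂ → ℂ}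

lemma add_four_rpow_le (k : ℝ) : ∃ B : ℝ, 0 ≤ B ∧ ∀ y : ℝ, 0 ≤ y → (4 + y) ^ k ≤ B * Real.exp y := by
  refine ⟨(⌈k⌉₊.factorial : ℝ) * Real.exp 4, by positivity, fun y hy => ?_⟩
  have h1 : (4 + y) ^ k ≤ (4 + y) ^ ((⌈k⌉₊ : ℕ) : ℝ) :=
    Real.rpow_le_rpow_of_exponent_le (by linarith) (Nat.le_ceil k)
  rw [Real.rpow_natCast] at h1
  have h2 := Real.pow_div_factorial_le_exp (4 + y) (by linarith) ⌈k⌉₊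
  rw [div_le_iff₀ (by positivity), Real.exp_add] at h2
  linarith

/-- A preliminary bound with uncontrolled exponent `k`, used only as the a priori growth for
Phragmén–Lindelöf. The condition `1 ≤ ‖s‖` allows `‖s‖ ^ ρ` to be compared with a larger exponent
whatever the sign of `ρ`. -/
lemma xi_expGrowth_away_from_zero (hG : IsEntireOfFiniteOrder G)
    (hGF : ∀ s : ℂ, s ≠ 1 → G s = (s - 1) ^ polarOrder F * F s) :
    ∃ k : ℝ, 0 ≤ k ∧ ExpGrowth {s | 1 / 2 ≤ s.re ∧ 1 ≤ ‖s‖} k (xi D F) := by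
  obtain ⟨hd, ρ, C, hC⟩ := hG
  set k := max ρ (3 / 2)
  have hk : 3 / 2 ≤ k := le_max_right _ _
  refine ⟨k, by linarith, ?_⟩
  have hG' : ExpGrowth {s | 1 / 2 ≤ s.re ∧ 1 ≤ ‖s‖} k G := by
    refine ⟨|C| + 1, by positivity, fun s hs => (hC s).trans ?_⟩
    have h1 : ‖s‖ ^ ρ ≤ (1 + ‖s‖) ^ k :=
      (Real.rpow_le_rpow_of_exponent_le hs.2 (le_max_left _ _)).trans
        (Real.rpow_le_rpow (norm_nonneg _) (by linarith) (by linarith))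
    have h2 : C ≤ Real.exp (|C| * (1 + ‖s‖) ^ k) := by
      have : |C| ≤ |C| * (1 + ‖s‖) ^ k :=
        le_mul_of_one_le_right (abs_nonneg _) (ExpGrowth.one_le_rpow (by linarith) s)
      linarith [Real.add_one_le_exp (|C| * (1 + ‖s‖) ^ k), le_abs_self C]
    rw [add_mul, one_mul, Real.exp_add]
    exact mul_le_mul h2 (Real.exp_le_exp.2 h1) (Real.exp_nonneg _) (Real.exp_nonneg _)
  have hid : ExpGrowth {s | 1 / 2 ≤ s.re ∧ 1 ≤ ‖s‖} k (fun s => s) :=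
    ExpGrowth.of_linear (A := 1) (by linarith) fun s _ => by simp
  obtain ⟨B, hB, h⟩ := ((hid.pow (by linarith) (polarOrder F)).mul
    ((D.expGrowth_gammaFactor.mono_exponent hk).mono_set fun s hs => hs.1)).mul hG'
  refine ⟨B, hB, fun s hs => ?_⟩
  rw [(xi_analyticAt_of_re_pos hd hGF (by linarith [hs.1])).2]
  exact h s hs

lemma xi_eq_of_one_lt_re (hG : Differentiable ℂ G)
    (hGF : ∀ s : ℂ, s ≠ 1 → G s = (s - 1) ^ polarOrder F * F s) {s : ℂ} (hs : 1 < s.re) :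
    xi D F s = rawXi D F s := by
  rw [(xi_analyticAt_of_re_pos hG hGF (by linarith)).2, hGF s (by rintro rfl; simp at hs), rawXi]
  ring

/-- Phragmén–Lindelöf replaces the unknown finite order of `G` by polynomial growth. On `Re s = 2`
the Dirichlet series and the gamma factor are bounded; `Re s = -1` is its mirror image. Dividing by
`(s + 3)^{2m}`, which does not vanish in the strip, reduces to bounded boundary values. -/
lemma xi_strip_bound (hDir : HasDirichletSeries F) (hD : SatisfiesFE D F)
    (hG : IsEntireOfFiniteOrder G)
    (hGF : ∀ s : ℂ, s ≠ 1 → G s = (s - 1) ^ polarOrder F * F s) :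
    ∃ K : ℝ, ∀ s : ℂ, -1 ≤ s.re → s.re ≤ 2 →
      ‖xi D F s‖ ≤ K * ‖s + 3‖ ^ (2 * polarOrder F) := by
  set m := polarOrder F
  obtain ⟨K₁, hK₁⟩ := D.gammaFactor_bounded_on_line
  obtain ⟨K₂, hK₂, hF⟩ := dirichlet_bounded hDir
  have hK₁0 : 0 ≤ K₁ := (norm_nonneg _).trans (hK₁ 2 (by simp))
  have hdiff := xi_differentiable hD hG.1 hGF
  have hone : ∀ s : ℂ, -1 ≤ s.re → 2 ≤ ‖s + 3‖ := fun s hs => by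
    have := (le_abs_self _).trans (abs_re_le_norm (s + 3))
    simp at this
    linarith
  have hline : ∀ s : ℂ, s.re = 2 → ‖xi D F s‖ ≤ K₁ * K₂ * (1 + ‖s‖) ^ (2 * m) := by
    intro s hs
    rw [xi_eq_of_one_lt_re hG.1 hGF (by rw [hs]; norm_num), rawXi, norm_mul, norm_mul, norm_mul,
      norm_pow, norm_pow, two_mul, pow_add]
    have h1 : ‖s - 1‖ ≤ 1 + ‖s‖ := by
      have := norm_sub_le s 1
      rw [norm_one] at this
      linarith
    have h2 : ‖s‖ ≤ 1 + ‖s‖ := by linarith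
    calc ‖s‖ ^ m * ‖s - 1‖ ^ m * ‖D.gammaFactor s‖ * ‖F s‖
        ≤ (1 + ‖s‖) ^ m * (1 + ‖s‖) ^ m * K₁ * K₂ := by
          gcongr
          · exact hK₁ s hs
          · exact hF s hs.ge
      _ = _ := by ring
  -- The factor `3` comes from `1 + ‖s‖ ≤ ‖s + 3‖ + 4 ≤ 3‖s + 3‖`, valid because `‖s + 3‖ ≥ 2`.
  set K := K₁ * K₂ * 3 ^ (2 * m)
  have hle : ∀ s : ℂ, s.re = 2 ∨ s.re = -1 → ‖xi D F s / (s + 3) ^ (2 * m)‖ ≤ K := by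
    intro s hs
    have h3 : 2 ≤ ‖s + 3‖ := hone s (by rcases hs with h | h <;> rw [h]; norm_num)
    rw [norm_div, norm_pow, div_le_iff₀ (by positivity), mul_assoc, ← mul_pow]
    have h4 : ‖s‖ ≤ ‖s + 3‖ + 3 := by
      have := norm_sub_le (s + 3) 3
      simpa using this
    rcases hs with hs | hs
    · refine (hline s hs).trans ?_
      gcongr
      linarith
    · rw [norm_xi_reflect hD]
      refine (hline _ (by simp [hs]; norm_num)).trans ?_
      gcongr
      have h7 : (1 - conj s).re = 2 := by simp [hs]; norm_num
      have h8 : (s + 3).re = 2 := by simp [hs]; norm_num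
      -- On `Re s = -1` both points have real part `2` and the same imaginary part.
      have h9 : ‖1 - conj s‖ = ‖s + 3‖ := by
        rw [Complex.norm_def, Complex.norm_def, normSq_apply, normSq_apply, h7, h8]
        simp
      rw [h9]
      linarith
  refine ⟨K, fun s h1 h2 => ?_⟩
  have hPL : ‖xi D F s / (s + 3) ^ (2 * m)‖ ≤ K := by
    refine PhragmenLindelof.vertical_strip (f := fun s => xi D F s / (s + 3) ^ (2 * m))
      (a := -1) (b := 2) ?_ ?_ (fun z hz => hle z (Or.inr hz)) (fun z hz => hle z (Or.inl hz)) h1 h2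
    · refine DifferentiableOn.diffContOnCl fun z hz => ?_
      rw [closure_preimage_re, closure_Ioo (by norm_num)] at hz
      have h3 := hone z hz.1
      refine DifferentiableAt.differentiableWithinAt (DifferentiableAt.div (hdiff z) (by fun_prop) ?_)
      exact pow_ne_zero _ (norm_pos_iff.1 (by linarith))
    -- The strip has width `3`, so growth `exp(B e^{|Im z|})` is admissible because `1 < π/3`.
    · refine ⟨1, ?_, ?_⟩
      · rw [lt_div_iff₀ (by norm_num)]
        linarith [Real.pi_gt_three]
      obtain ⟨k, hk, C, hC, hgrow⟩ := xi_expGrowth_away_from_zero (D := D) hG hGF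
      obtain ⟨B, hB, hBk⟩ := add_four_rpow_le k
      refine ⟨C * B, Asymptotics.IsBigO.of_bound 1 ?_⟩
      have hev : ∀ᶠ z : ℂ in comap (_root_.abs ∘ im) atTop, 1 ≤ |z.im| :=
        (eventually_ge_atTop (1 : ℝ)).comap _
      filter_upwards [hev.filter_mono inf_le_left, mem_inf_of_right (mem_principal_self _)]
        with z hz1 hz2
      have hz2' : -1 < z.re ∧ z.re < 2 := hz2
      have hbound : ∀ w : ℂ, 1 / 2 ≤ w.re → w.re ≤ 2 → 1 ≤ |w.im| →
          ‖xi D F w‖ ≤ Real.exp (C * B * Real.exp |w.im|) := by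
        intro w hw1 hw2 hw3
        refine (hgrow w ⟨hw1, hw3.trans (abs_im_le_norm w)⟩).trans (Real.exp_le_exp.2 ?_)
        rw [mul_assoc]
        refine mul_le_mul_of_nonneg_left (le_trans ?_ (hBk |w.im| (abs_nonneg _))) hC
        refine Real.rpow_le_rpow (by positivity) ?_ hk
        have := norm_le_abs_re_add_abs_im w
        rw [abs_of_nonneg (by linarith : 0 ≤ w.re)] at this
        linarith
      have hxi : ‖xi D F z‖ ≤ Real.exp (C * B * Real.exp |z.im|) := by
        rcases le_total (1 / 2) z.re with h | h
        · exact hbound z h hz2'.2.le hz1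
        · rw [norm_xi_reflect hD]
          have := hbound (1 - conj z) (by simp; linarith) (by simp; linarith) (by simpa using hz1)
          simpa using this
      rw [one_mul, one_mul, norm_div, Real.norm_eq_abs, Real.abs_exp]
      refine (div_le_self (norm_nonneg _) ?_).trans hxi
      rw [norm_pow]
      exact one_le_pow₀ (by linarith [hone z hz2'.1.le])
  have h3 := hone s h1
  rwa [norm_div, norm_pow, div_le_iff₀ (by positivity)] at hPL

/-- To the right of the strip the gamma factor dominates, inside it the bound is polynomial, and the
left side follows by reflection. -/
lemma xi_expGrowth (hDir : HasDirichletSeries F) (hD : SatisfiesFE D F)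
    (hG : IsEntireOfFiniteOrder G)
    (hGF : ∀ s : ℂ, s ≠ 1 → G s = (s - 1) ^ polarOrder F * F s) :
    ExpGrowth Set.univ (3 / 2) (xi D F) := by
  have hright : ExpGrowth {s | 2 ≤ s.re} (3 / 2) (xi D F) := by
    obtain ⟨K, hK, hF⟩ := dirichlet_bounded hDir
    have hid : ExpGrowth {s | 2 ≤ s.re} (3 / 2) (fun s => s) :=
      ExpGrowth.of_linear (A := 1) (by norm_num) fun s _ => by simp
    have hid1 : ExpGrowth {s | 2 ≤ s.re} (3 / 2) (fun s => s - 1) :=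
      ExpGrowth.of_linear (A := 1) (by norm_num) fun s _ => by
        have := norm_sub_le s 1
        rw [norm_one] at this
        linarith
    obtain ⟨B, hB, h⟩ := (((hid.pow (by norm_num) (polarOrder F)).mul
      (hid1.pow (by norm_num) (polarOrder F))).mul (D.expGrowth_gammaFactor.mono_set
        (fun s (hs : 2 ≤ s.re) => show 1 / 2 ≤ s.re by linarith))).mul
      (ExpGrowth.of_bound (S := {s | 2 ≤ s.re}) (by norm_num) (K := K) hF)
    refine ⟨B, hB, fun s hs => ?_⟩
    have hs' : 2 ≤ s.re := hs
    rw [xi_eq_of_one_lt_re hG.1 hGF (by linarith)]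
    exact h s hs
  have hstrip : ExpGrowth {s | -1 ≤ s.re ∧ s.re ≤ 2} (3 / 2) (xi D F) := by
    obtain ⟨K, hK⟩ := xi_strip_bound hDir hD hG hGF
    have hid3 : ExpGrowth {s | -1 ≤ s.re ∧ s.re ≤ 2} (3 / 2) (fun s => s + 3) :=
      ExpGrowth.of_linear (A := 3) (by norm_num) fun s _ => by
        have := norm_add_le s 3
        norm_num at this
        linarith [norm_nonneg s]
    obtain ⟨B, hB, h⟩ := (ExpGrowth.of_bound (S := {s | -1 ≤ s.re ∧ s.re ≤ 2})
      (f := fun _ => ((|K| : ℝ) : ℂ)) (by norm_num) (K := |K|) (fun s _ => by simp)).mul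
      (hid3.pow (by norm_num) (2 * polarOrder F))
    refine ⟨B, hB, fun s hs => (hK s hs.1 hs.2).trans (le_trans ?_ (h s hs))⟩
    rw [norm_mul, norm_pow, norm_real, Real.norm_eq_abs, abs_abs]
    gcongr
    exact le_abs_self K
  have hleft := hright.reflect (by norm_num) (norm_xi_reflect hD)
  refine ((hright.union hstrip).union hleft).mono_set fun s _ => ?_
  rcases le_total 2 s.re with h | h
  · exact Or.inl (Or.inl h)
  · rcases le_total (-1) s.re with h' | h'
    · exact Or.inl (Or.inr ⟨h', h⟩)
    · refine Or.inr ?_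
      show 2 ≤ (1 - conj s).re
      simp
      linarith

lemma xi_zeros_in_strip (hDir : HasDirichletSeries F) (hD : SatisfiesFE D F)
    (hG : Differentiable ℂ G)
    (hGF : ∀ s : ℂ, s ≠ 1 → G s = (s - 1) ^ polarOrder F * F s) (h2 : xi D F 2 ≠ 0) :
    ∃ A : ℝ, 0 ≤ A ∧ ∀ s : ℂ, xi D F s = 0 → |s.re - 1 / 2| ≤ A := by
  have hF2 : F 2 ≠ 0 := fun h => h2 (by
    rw [xi_eq_of_one_lt_re hG hGF (by norm_num), rawXi, h, mul_zero])
  obtain ⟨A, hA, hne⟩ := exists_zero_free_half_plane hDir hF2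
  have hxi : ∀ s : ℂ, A ≤ s.re → xi D F s ≠ 0 := fun s hs => by
    have hs1 : 1 < s.re := hA.trans_le hs
    rw [xi_eq_of_one_lt_re hG hGF hs1, rawXi]
    refine mul_ne_zero (mul_ne_zero (mul_ne_zero (pow_ne_zero _ ?_) (pow_ne_zero _ ?_))
      (D.gammaFactor_ne_zero (by linarith))) (hne s hs)
    · rintro rfl
      simp at hs1
      linarith
    · rw [sub_ne_zero]
      rintro rfl
      simp at hs1
  refine ⟨A, by linarith, fun s hs => ?_⟩
  rw [abs_le]
  constructor
  · by_contra! h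
    refine hxi (1 - conj s) (by simp; linarith) (norm_eq_zero.1 ?_)
    rw [← norm_xi_reflect hD, hs, norm_zero]
  · by_contra! h
    exact hxi s (by linarith) hs

end

end ExtSelberg

/-! ### Counting zeros by Jensen's inequality -/

namespace ExtSelberg
open Complex Filter

section

variable {f : ℂ → ℂ}

lemma eventually_ne_zero_punctured (hf : Differentiable ℂ f) {c : ℂ} (hc : f c ≠ 0) (z : ℂ) :
    ∀ᶠ w in 𝓝[≠] z, f w ≠ 0 := by
  rcases (hf.analyticAt z).eventually_eq_zero_or_eventually_ne_zero with h | h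
  · exact absurd ((AnalyticOnNhd.eqOn_of_preconnected_of_eventuallyEq
      (fun w _ => hf.analyticAt w) (fun w _ => analyticAt_const) isPreconnected_univ
      (Set.mem_univ z) h) (Set.mem_univ c)) hc
  · exact h

lemma untop_map_natCast (n : ℕ∞) : (ENat.map (Nat.cast : ℕ → ℤ) n).untop₀ = (n.toNat : ℤ) := by
  cases n <;> rfl

/-- Jensen's inequality centred at `c` rather than at `0`, where `f` may vanish. The outer radius is
`e` times the inner one, so the denominator `log (R/r)` equals `1`. -/
lemma exists_zero_count_le (hf : Differentiable ℂ f) (hg : ExpGrowth Set.univ (3 / 2) f)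
    {c : ℂ} (hc : f c ≠ 0) :
    ∃ B : ℝ, 0 ≤ B ∧ ∀ R : ℝ, 1 ≤ R → ∀ S : Finset ℂ, (∀ γ ∈ S, ‖γ‖ ≤ R) →
      ∑ γ ∈ S, (analyticOrderNatAt f γ : ℝ) ≤ B * R ^ (3 / 2 : ℝ) := by
  obtain ⟨C, hC, hg⟩ := hg
  -- Chosen so that `1 + ‖z‖ ≤ q * R` on the sphere of radius `e (R + ‖c‖)` about `c`, for `R ≥ 1`.
  set q := (1 + ‖c‖) + Real.exp 1 * (1 + ‖c‖)
  have hq : 0 ≤ q := by positivity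
  refine ⟨C * q ^ (3 / 2 : ℝ) + |Real.log ‖f c‖|, by positivity, fun R hR S hS => ?_⟩
  set r := R + ‖c‖
  have hr : 0 < r := by positivity
  have he : (1 : ℝ) < Real.exp 1 := by
    have := Real.add_one_lt_exp (one_ne_zero)
    linarith
  have hf' : AnalyticOnNhd ℂ f Set.univ := fun w _ => hf.analyticAt w
  have hone : 1 ≤ R ^ (3 / 2 : ℝ) := Real.one_le_rpow hR (by norm_num)
  have hJ := AnalyticOnNhd.sum_divisor_le (c := c) (r := r) (R := Real.exp 1 * r)
    (M := Real.exp (C * q ^ (3 / 2 : ℝ) * R ^ (3 / 2 : ℝ))) (f := f) (by positivity)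
    (by rw [abs_of_pos hr, abs_of_pos (by positivity)]; nlinarith)
    (Real.one_le_exp (by positivity)) (hf'.mono (Set.subset_univ _)) hc (by
      intro z hz
      refine (hg z (Set.mem_univ z)).trans (Real.exp_le_exp.2 ?_)
      rw [mul_assoc, ← Real.mul_rpow hq (by linarith)]
      gcongr
      rw [mem_sphere_iff_norm, abs_of_pos (by positivity)] at hz
      have h1 : ‖z‖ ≤ ‖z - c‖ + ‖c‖ := by
        have := norm_add_le (z - c) c
        simpa using this
      have h2 : q * R - (1 + (Real.exp 1 * r + ‖c‖)) =
          (1 + ‖c‖) * (R - 1) + Real.exp 1 * (‖c‖ * (R - 1)) := by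
        simp only [q, r]; ring
      have h3 : 0 ≤ (1 + ‖c‖) * (R - 1) + Real.exp 1 * (‖c‖ * (R - 1)) := by
        have : 0 ≤ R - 1 := by linarith
        positivity
      linarith)
  rw [mul_div_assoc, div_self hr.ne', mul_one, Real.log_exp, div_one,
    Real.log_div (Real.exp_ne_zero _) (norm_ne_zero_iff.2 hc), Real.log_exp] at hJ
  set d := MeromorphicOn.divisor f (Metric.closedBall c |r|)
  have hd0 : ∀ u, 0 ≤ d u := fun u => by
    by_cases hu : u ∈ Metric.closedBall c |r|
    · rw [MeromorphicOn.AnalyticOnNhd.divisor_apply (hf'.mono (Set.subset_univ _)) hu,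
        untop_map_natCast]
      positivity
    · rw [Function.locallyFinsuppWithin.apply_eq_zero_of_notMem _ hu]
  have hfin : (Function.support d).Finite := d.finiteSupport (isCompact_closedBall ..)
  have hsum : ∑ γ ∈ S, (analyticOrderNatAt f γ : ℤ) ≤ ∑ᶠ u, d u := by
    rw [finsum_eq_sum_of_support_subset (s := S ∪ hfin.toFinset) _
      (fun u hu => by simp only [Finset.coe_union, Set.Finite.coe_toFinset]; exact Or.inr hu)]
    refine le_trans (Finset.sum_le_sum fun γ hγ => ?_)
      (Finset.sum_le_sum_of_subset_of_nonneg Finset.subset_union_left fun u _ _ => hd0 u)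
    rw [MeromorphicOn.AnalyticOnNhd.divisor_apply (hf'.mono (Set.subset_univ _)),
      untop_map_natCast]
    · rfl
    · rw [Metric.mem_closedBall, dist_eq_norm, abs_of_pos hr]
      exact (norm_sub_le _ _).trans (by simp only [r]; linarith [hS γ hγ])
  have hsum' : ∑ γ ∈ S, (analyticOrderNatAt f γ : ℝ) ≤ ((∑ᶠ u, d u : ℤ) : ℝ) := by
    exact_mod_cast hsum
  have h4 : -Real.log ‖f c‖ ≤ |Real.log ‖f c‖| * R ^ (3 / 2 : ℝ) :=
    (neg_le_abs _).trans (le_mul_of_one_le_right (abs_nonneg _) hone)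
  linarith

/-- Dyadic summation: the shell `‖γ‖ ≈ 2^k` contributes at most `B 2^{3(k+1)/2} / 4^k`, a geometric
sequence of ratio `2^{3/2}/4 < 1`. -/
lemma summable_order_div_max_sq {m : ℂ → ℕ} {B : ℝ} (hB : 0 ≤ B)
    (h : ∀ R : ℝ, 1 ≤ R → ∀ S : Finset ℂ, (∀ γ ∈ S, ‖γ‖ ≤ R) →
      ∑ γ ∈ S, (m γ : ℝ) ≤ B * R ^ (3 / 2 : ℝ)) :
    Summable fun γ : ℂ => (m γ : ℝ) / (max 1 ‖γ‖) ^ 2 := by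
  classical
  set q : ℝ := 2 ^ (3 / 2 : ℝ) / 4
  have hq1 : q < 1 := by
    have : (2 : ℝ) ^ (3 / 2 : ℝ) < 2 ^ (2 : ℝ) :=
      Real.rpow_lt_rpow_of_exponent_lt (by norm_num) (by norm_num)
    norm_num at this
    simp only [q]
    linarith
  have hq0 : 0 ≤ q := by positivity
  have hgeo : Summable fun k : ℕ => B * 2 ^ (3 / 2 : ℝ) * q ^ k :=
    (summable_geometric_of_lt_one hq0 hq1).mul_left _
  refine summable_of_sum_le (c := ∑' k : ℕ, B * 2 ^ (3 / 2 : ℝ) * q ^ k)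
    (fun γ => by positivity) fun S => ?_
  -- The logarithm of `0` is `0`, so the unit disc falls into the shell `k = 0`.
  let κ : ℂ → ℕ := fun γ => Nat.log 2 ⌊‖γ‖⌋₊
  have hκ1 : ∀ γ, (2 : ℝ) ^ κ γ ≤ max 1 ‖γ‖ := fun γ => by
    rcases Nat.eq_zero_or_pos ⌊‖γ‖⌋₊ with h0 | h0
    · simp [κ, h0]
    · have h1 : 2 ^ κ γ ≤ ⌊‖γ‖⌋₊ := Nat.pow_log_le_self 2 h0.ne'
      have h2 : ((2 ^ κ γ : ℕ) : ℝ) ≤ ‖γ‖ :=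
        (Nat.cast_le.2 h1).trans (Nat.floor_le (norm_nonneg _))
      push_cast at h2
      exact h2.trans (le_max_right _ _)
  have hκ2 : ∀ γ, ‖γ‖ ≤ (2 : ℝ) ^ (κ γ + 1) := fun γ => by
    have h1 : ⌊‖γ‖⌋₊ + 1 ≤ 2 ^ (κ γ + 1) := Nat.lt_pow_succ_log_self (by norm_num) _
    have h2 : ((⌊‖γ‖⌋₊ + 1 : ℕ) : ℝ) ≤ ((2 ^ (κ γ + 1) : ℕ) : ℝ) := Nat.cast_le.2 h1
    push_cast at h2
    linarith [Nat.lt_floor_add_one ‖γ‖]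
  rw [← Finset.sum_fiberwise_of_maps_to (t := S.image κ) (g := κ)
    (fun γ hγ => Finset.mem_image_of_mem κ hγ)]
  refine le_trans (Finset.sum_le_sum fun k _ => ?_)
    (hgeo.sum_le_tsum (S.image κ) fun k _ => by positivity)
  have hR := h (2 ^ (k + 1)) (one_le_pow₀ (by norm_num)) (S.filter fun γ => κ γ = k)
    (fun γ hγ => by
      rw [Finset.mem_filter] at hγ
      rw [← hγ.2]
      exact hκ2 γ)
  have h4 : ∑ γ ∈ S.filter (fun γ => κ γ = k), (m γ : ℝ) / (max 1 ‖γ‖) ^ 2 ≤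
      (∑ γ ∈ S.filter (fun γ => κ γ = k), (m γ : ℝ)) / 4 ^ k := by
    rw [Finset.sum_div]
    refine Finset.sum_le_sum fun γ hγ => ?_
    rw [Finset.mem_filter] at hγ
    have h5 : (4 : ℝ) ^ k ≤ max 1 ‖γ‖ ^ 2 := by
      rw [show (4 : ℝ) = 2 ^ 2 by norm_num, ← pow_mul, mul_comm, pow_mul, ← hγ.2]
      gcongr
      exact hκ1 γ
    gcongr
  refine h4.trans ?_
  rw [div_le_iff₀ (by positivity)]
  refine hR.trans_eq ?_
  have h6 : ((2 : ℝ) ^ (k + 1)) ^ (3 / 2 : ℝ) = 2 ^ (3 / 2 : ℝ) * (2 ^ (3 / 2 : ℝ)) ^ k := by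
    rw [← Real.rpow_natCast, ← Real.rpow_natCast, ← Real.rpow_mul (by norm_num),
      ← Real.rpow_mul (by norm_num), ← Real.rpow_add (by norm_num)]
    congr 1
    push_cast
    ring
  rw [h6, div_pow]
  field_simp

lemma summable_order_div_sq (hf : Differentiable ℂ f) (hg : ExpGrowth Set.univ (3 / 2) f)
    {c : ℂ} (hc : f c ≠ 0) :
    Summable fun γ : ℂ => (analyticOrderNatAt f γ : ℝ) / ‖γ‖ ^ 2 := by
  obtain ⟨B, hB, hcount⟩ := exists_zero_count_le hf hg hc
  have hs := summable_order_div_max_sq hB hcount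
  have hev := eventually_ne_zero_punctured hf hc 0
  rw [eventually_nhdsWithin_iff, Metric.eventually_nhds_iff] at hev
  obtain ⟨ε, hε, hev⟩ := hev
  set δ := min ε 1
  have hδ : 0 < δ := lt_min hε one_pos
  refine Summable.of_nonneg_of_le (fun γ => by positivity) (fun γ => ?_)
    (hs.mul_left (1 / δ ^ 2))
  -- At `γ = 0` the left side is `0`, division by zero being zero. Other zeros keep a distance at
  -- least `ε` from the origin.
  rcases eq_or_ne γ 0 with rfl | hγ
  · simp
    positivity
  by_cases hm : analyticOrderNatAt f γ = 0
  · simp [hm]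
  have h0 := apply_eq_zero_of_analyticOrderNatAt_ne_zero hm
  have h1 : ε ≤ ‖γ‖ := by
    by_contra! hlt
    exact hev (by simpa using hlt) hγ h0
  have h2 : δ * max 1 ‖γ‖ ≤ ‖γ‖ := by
    rcases max_cases 1 ‖γ‖ with ⟨h, _⟩ | ⟨h, _⟩ <;> rw [h]
    · linarith [min_le_left ε 1]
    · nlinarith [min_le_right ε 1, norm_nonneg γ]
  have h3 : 0 < max 1 ‖γ‖ := by positivity
  rw [div_mul_div_comm, one_mul, ← mul_pow]
  gcongr

end

end ExtSelberg

/-! ### Landau's theorem for Laplace transforms -/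

namespace ExtSelberg
open Complex Filter MeasureTheory ProbabilityTheory

section Landau

/-- For the variable `t ↦ -t`, `complexMGF` is the Laplace transform and `integrableExpSet` its set
of real points of convergence. -/
lemma integrableExpSet_neg_upward_closed {μ : Measure ℝ} (hμ : ∀ᵐ t ∂μ, 0 ≤ t) {x y : ℝ}
    (hx : x ∈ integrableExpSet (fun t : ℝ => -t) μ) (hxy : x ≤ y) :
    y ∈ integrableExpSet (fun t : ℝ => -t) μ := by
  refine Integrable.mono' (hx : Integrable (fun t => Real.exp (x * -t)) μ)
    (by fun_prop) ?_
  filter_upwards [hμ] with t ht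
  rw [Real.norm_eq_abs, Real.abs_exp]
  gcongr 1
  nlinarith

lemma frequently_punctured_of_real {P : ℂ → Prop} {c : ℝ} (h : ∀ᶠ x : ℝ in 𝓝 c, P x) :
    ∃ᶠ z in 𝓝[≠] (c : ℂ), P z := by
  have ht : Tendsto (fun x : ℝ => (x : ℂ)) (𝓝[≠] c) (𝓝[≠] (c : ℂ)) := by
    refine tendsto_nhdsWithin_of_tendsto_nhds_of_eventually_within _
      (continuous_ofReal.continuousAt.tendsto.mono_left nhdsWithin_le_nhds) ?_
    filter_upwards [self_mem_nhdsWithin] with x hx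
    simpa using hx
  exact ht.frequently (h.filter_mono nhdsWithin_le_nhds).frequently

/-- If the Taylor expansion of the Laplace transform of a measure on `[0, ∞)` at a real point `c`
converges at distance `r`, then the Laplace integral converges at `c - r`. -/
lemma mem_integrableExpSet_of_summable_taylor {μ : Measure ℝ} (hμ : ∀ᵐ t ∂μ, 0 ≤ t) {c r : ℝ}
    (hr : 0 ≤ r) (hc : c ∈ interior (integrableExpSet (fun t : ℝ => -t) μ))
    (hs : Summable fun n : ℕ =>
      ((n.factorial : ℂ)⁻¹ • (-r : ℂ) ^ n •
        iteratedDeriv n (complexMGF (fun t : ℝ => -t) μ) c)) :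
    c - r ∈ integrableExpSet (fun t : ℝ => -t) μ := by
  -- The `n`-th Taylor term at distance `r` to the left of `c` is the integral of `T n ≥ 0`: the
  -- sign of `(-r)^n` cancels that of `(-t)^n`. Tonelli then permits summation under the integral,
  -- where the sum is `e^{-(c-r)t}`.
  let T : ℕ → ℝ → ℝ := fun n t => (r * t) ^ n / n.factorial * Real.exp (c * -t)
  have hTint : ∀ n, Integrable (T n) μ := fun n => by
    have h := (integrable_pow_abs_mul_exp_of_mem_interior_integrableExpSet hc n).const_mul
      (r ^ n / n.factorial)
    refine h.congr ?_
    filter_upwards [hμ] with t ht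
    simp only [T, abs_neg, abs_of_nonneg ht, mul_pow]
    ring
  have hT0 : ∀ n, 0 ≤ᵐ[μ] T n := fun n => by
    filter_upwards [hμ] with t ht
    simp only [T, Pi.zero_apply]
    positivity
  have hTI : ∀ n, ((n.factorial : ℂ)⁻¹ • (-r : ℂ) ^ n •
      iteratedDeriv n (complexMGF (fun t : ℝ => -t) μ) c) = ((∫ t, T n t ∂μ : ℝ) : ℂ) := by
    intro n
    rw [iteratedDeriv_complexMGF (by simpa using hc), ← integral_complex_ofReal, smul_eq_mul, smul_eq_mul,
      ← mul_assoc, ← integral_const_mul]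
    congr 1
    ext t
    simp only [T]
    push_cast
    rw [mul_pow, neg_pow (r : ℂ), neg_pow (t : ℂ)]
    have : (-1 : ℂ) ^ n * (-1) ^ n = 1 := by rw [← mul_pow]; simp
    linear_combination ((n.factorial : ℂ)⁻¹ * r ^ n * t ^ n * cexp (c * -t)) * this
  have hsum : Summable fun n => ∫ t, T n t ∂μ := by
    have := hs.congr hTI
    exact_mod_cast this
  have hlim : ∀ t : ℝ, HasSum (fun n => T n t) (Real.exp ((c - r) * -t)) := fun t => by
    have h := (NormedSpace.expSeries_div_hasSum_exp (r * t)).mul_right (Real.exp (c * -t))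
    rwa [← Real.exp_eq_exp_ℝ, ← Real.exp_add, show r * t + c * -t = (c - r) * -t by ring] at h
  refine ⟨by fun_prop, ?_⟩
  rw [hasFiniteIntegral_iff_ofReal (ae_of_all _ fun t => (Real.exp_pos _).le)]
  calc ∫⁻ t, ENNReal.ofReal (Real.exp ((c - r) * -t)) ∂μ
      = ∫⁻ t, ∑' n, ENNReal.ofReal (T n t) ∂μ := by
        refine lintegral_congr_ae ?_
        filter_upwards [ae_all_iff.2 hT0] with t ht
        rw [← ENNReal.ofReal_tsum_of_nonneg ht (hlim t).summable, (hlim t).tsum_eq]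
    _ = ∑' n, ∫⁻ t, ENNReal.ofReal (T n t) ∂μ :=
        lintegral_tsum fun n => (hTint n).aemeasurable.ennreal_ofReal
    _ = ∑' n, ENNReal.ofReal (∫ t, T n t ∂μ) :=
        tsum_congr fun n => (ofReal_integral_eq_lintegral_ofReal (hTint n) (hT0 n)).symm
    _ = ENNReal.ofReal (∑' n, ∫ t, T n t ∂μ) :=
        (ENNReal.ofReal_tsum_of_nonneg (fun n => integral_nonneg_of_ae (hT0 n)) hsum).symm
    _ < ⊤ := ENNReal.ofReal_lt_top

/-- **Landau's theorem** for Laplace transforms of measures on `[0, ∞)`. -/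
theorem Ioi_subset_integrableExpSet_of_analyticAt {μ : Measure ℝ} (hμ : ∀ᵐ t ∂μ, 0 ≤ t)
    {x₀ : ℝ} (hint : ∀ x, x₀ < x → x ∈ integrableExpSet (fun t : ℝ => -t) μ) {H : ℂ → ℂ}
    (hH : ∀ x : ℝ, 0 < x → AnalyticAt ℂ H x)
    (heq : ∀ x : ℝ, x₀ < x → H x = complexMGF (fun t : ℝ => -t) μ x) :
    Set.Ioi 0 ⊆ integrableExpSet (fun t : ℝ => -t) μ := by
  set S := integrableExpSet (fun t : ℝ => -t) μ
  by_contra hcon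
  rw [Set.not_subset] at hcon
  obtain ⟨x₁, hx₁, hx₁S⟩ := hcon
  have hbdd : BddAbove Sᶜ := ⟨x₀, fun x hx => not_lt.1 fun h => hx (hint x h)⟩
  -- The abscissa of convergence, assumed positive for contradiction.
  set σ := sSup Sᶜ
  have hσ0 : 0 < σ := lt_of_lt_of_le hx₁ (le_csSup hbdd hx₁S)
  have hσS : Set.Ioi σ ⊆ S := fun x hx => by
    by_contra h
    exact absurd (le_csSup hbdd h) (not_le.2 hx)
  have hint' : ∀ x, σ < x → x ∈ interior S := fun x hx =>
    interior_mono hσS (by rw [interior_Ioi]; exact hx)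
  have hL : ∀ x : ℝ, σ < x → AnalyticAt ℂ (complexMGF (fun t : ℝ => -t) μ) x := fun x hx =>
    analyticAt_complexMGF (by simpa using hint' x hx)
  have hEq : Set.EqOn H (complexMGF (fun t : ℝ => -t) μ) ((fun x : ℝ => (x : ℂ)) '' Set.Ioi σ) := by
    have hy : max σ x₀ + 1 ∈ Set.Ioi σ := by
      have := le_max_left σ x₀
      simp only [Set.mem_Ioi]; linarith
    refine AnalyticOnNhd.eqOn_of_preconnected_of_frequently_eq (z₀ := ((max σ x₀ + 1 : ℝ) : ℂ)) ?_ ?_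
      (isPreconnected_Ioi.image _ continuous_ofReal.continuousOn) ⟨_, hy, rfl⟩
      (frequently_punctured_of_real ?_)
    · rintro _ ⟨x, hx, rfl⟩
      exact hH x (hσ0.trans hx)
    · rintro _ ⟨x, hx, rfl⟩
      exact hL x hx
    · have : x₀ < max σ x₀ + 1 := by linarith [le_max_right σ x₀]
      filter_upwards [lt_mem_nhds this] with x hx using heq x hx
  obtain ⟨ε, hε, hball⟩ := Metric.eventually_nhds_iff_ball.1
    (hH σ hσ0).eventually_analyticAt
  -- The ball of radius `2δ` about `σ + δ` lies in the ball of radius `ε` about `σ`, where `H` is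
  -- analytic. A Taylor step of length `3δ/2` to the left lands at `σ - δ/2`, beyond the abscissa.
  set δ := ε / 3
  have hδ : 0 < δ := by positivity
  have hd : DifferentiableOn ℂ H (Metric.ball ((σ + δ : ℝ) : ℂ) (2 * δ)) := fun z hz => by
    refine (hball z ?_).differentiableAt.differentiableWithinAt
    rw [Metric.mem_ball, dist_eq_norm] at hz ⊢
    have h1 : z - σ = (z - (σ + δ : ℝ)) + (δ : ℝ) := by push_cast; ring
    have h2 : ‖((δ : ℝ) : ℂ)‖ = δ := by rw [norm_real, Real.norm_eq_abs, abs_of_pos hδ]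
    rw [h1]
    refine (norm_add_le _ _).trans_lt ?_
    rw [h2]
    simp only [δ] at hz ⊢
    linarith
  have hmem : (((σ + δ : ℝ) : ℂ) + -((3 / 2 * δ : ℝ) : ℂ)) ∈
      Metric.ball ((σ + δ : ℝ) : ℂ) (2 * δ) := by
    rw [Metric.mem_ball, dist_eq_norm, add_sub_cancel_left, norm_neg, norm_real,
      Real.norm_eq_abs, abs_of_pos (by positivity)]
    linarith
  have hT := (hasSum_taylorSeries_on_ball hd hmem).summable
  simp only [add_sub_cancel_left] at hT
  have hcσ : σ < σ + δ := by linarith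
  have hev : H =ᶠ[𝓝 ((σ + δ : ℝ) : ℂ)] complexMGF (fun t : ℝ => -t) μ := by
    refine (AnalyticAt.frequently_eq_iff_eventually_eq (hH _ (hσ0.trans hcσ)) (hL _ hcσ)).1
      (frequently_punctured_of_real ?_)
    filter_upwards [lt_mem_nhds hcσ] with x hx using hEq ⟨x, hx, rfl⟩
  simp only [hev.iteratedDeriv_eq] at hT
  have hfin := mem_integrableExpSet_of_summable_taylor hμ (by positivity) (hint' _ hcσ) hT
  have hsup : σ ≤ σ + δ - 3 / 2 * δ := by
    refine csSup_le ⟨x₁, hx₁S⟩ fun x hx => ?_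
    by_contra! hlt
    exact hx (integrableExpSet_neg_upward_closed hμ hfin hlt.le)
  linarith

end Landau

end ExtSelberg

/-! ### Laplace transforms of exponential sums -/

namespace ExtSelberg
open Complex Filter MeasureTheory ProbabilityTheory

section ExponentialSums

/-- The Laplace transform of `t ↦ Re (c e^{pt})`. -/
noncomputable def conjPole (c p w : ℂ) : ℂ := (c / (w - p) + conj c / (w - conj p)) / 2

lemma integrable_exp_mul_neg_mul_exp {p w : ℂ} (h : p.re < w.re) (c : ℂ) :
    Integrable (fun t : ℝ => cexp (w * (-t : ℝ)) * (c * cexp (p * t)))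
      (volume.restrict (Set.Ioi 0)) := by
  have := ((integrableOn_exp_mul_complex_Ioi (a := p - w) (by simpa using h) 0).integrable).const_mul c
  refine this.congr (ae_of_all _ fun t => ?_)
  show c * cexp ((p - w) * t) = cexp (w * (-t : ℝ)) * (c * cexp (p * t))
  rw [mul_left_comm, ← Complex.exp_add]
  congr 2
  push_cast
  ring

lemma integral_exp_mul_neg_mul_exp {p w : ℂ} (h : p.re < w.re) (c : ℂ) :
    ∫ t : ℝ in Set.Ioi 0, cexp (w * (-t : ℝ)) * (c * cexp (p * t)) = c / (w - p) := by
  have h1 := integral_exp_mul_complex_Ioi (a := p - w) (by simpa using h) 0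
  have h2 : ∀ t : ℝ, cexp (w * (-t : ℝ)) * (c * cexp (p * t)) = c * cexp ((p - w) * t) := by
    intro t
    rw [mul_left_comm, ← Complex.exp_add]
    congr 2
    push_cast
    ring
  simp_rw [h2]
  rw [integral_const_mul, h1, ofReal_zero, mul_zero, Complex.exp_zero, ← neg_sub w p, div_neg,
    neg_div, neg_neg, mul_one_div]

lemma ofReal_re_mul_exp (c p : ℂ) (t : ℝ) :
    (((c * cexp (p * t)).re : ℝ) : ℂ) =
      (c * cexp (p * t)) / 2 + (conj c * cexp (conj p * t)) / 2 := by
  rw [re_eq_add_conj, map_mul, ← exp_conj, map_mul, conj_ofReal, add_div]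

lemma integrable_laplace_re_exp {p w : ℂ} (h : p.re < w.re) (c : ℂ) :
    Integrable (fun t : ℝ => cexp (w * (-t : ℝ)) * (((c * cexp (p * t)).re : ℝ) : ℂ))
      (volume.restrict (Set.Ioi 0)) := by
  have h1 := (integrable_exp_mul_neg_mul_exp h c).div_const 2
  have h2 := (integrable_exp_mul_neg_mul_exp (p := conj p) (w := w) (by simpa using h)
    (conj c)).div_const 2
  refine (h1.add h2).congr (ae_of_all _ fun t => ?_)
  beta_reduce
  rw [ofReal_re_mul_exp, Pi.add_apply]
  ring

lemma laplace_re_exp {p w : ℂ} (h : p.re < w.re) (c : ℂ) :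
    ∫ t : ℝ in Set.Ioi 0, cexp (w * (-t : ℝ)) * (((c * cexp (p * t)).re : ℝ) : ℂ) =
      conjPole c p w := by
  have h1 := (integrable_exp_mul_neg_mul_exp h c).div_const 2
  have h2 := (integrable_exp_mul_neg_mul_exp (p := conj p) (w := w) (by simpa using h)
    (conj c)).div_const 2
  have h3 : ∀ t : ℝ, cexp (w * (-t : ℝ)) * (((c * cexp (p * t)).re : ℝ) : ℂ) =
      cexp (w * (-t : ℝ)) * (c * cexp (p * t)) / 2 +
        cexp (w * (-t : ℝ)) * (conj c * cexp (conj p * t)) / 2 := fun t => by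
    rw [ofReal_re_mul_exp]; ring
  simp_rw [h3]
  rw [integral_add h1 h2, integral_div, integral_div, integral_exp_mul_neg_mul_exp h,
    integral_exp_mul_neg_mul_exp (by simpa using h), conjPole, add_div]

variable {ι : Type*} {c p : ι → ℂ} {A : ℝ}

lemma norm_mul_exp_le (hA : ∀ i, |(p i).re| ≤ A) (i : ι) (t : ℝ) :
    ‖c i * cexp (p i * t)‖ ≤ ‖c i‖ * Real.exp (A * |t|) := by
  rw [norm_mul, norm_exp]
  gcongr
  rw [re_mul_ofReal]
  refine (le_abs_self _).trans ?_
  rw [abs_mul]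
  gcongr
  exact hA i

lemma summable_mul_exp (hc : Summable fun i => ‖c i‖) (hA : ∀ i, |(p i).re| ≤ A) (t : ℝ) :
    Summable fun i => c i * cexp (p i * t) :=
  Summable.of_norm_bounded (hc.mul_right _) fun i => norm_mul_exp_le hA i t

lemma continuous_re_tsum_exp (hc : Summable fun i => ‖c i‖) (hA : ∀ i, |(p i).re| ≤ A) :
    Continuous fun t : ℝ => ∑' i, (c i * cexp (p i * t)).re := by
  rw [continuous_iff_continuousAt]
  intro t₀
  have hcont : ContinuousOn (fun t : ℝ => ∑' i, (c i * cexp (p i * t)).re)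
      (Metric.ball t₀ 1) := by
    refine continuousOn_tsum (u := fun i => ‖c i‖ * Real.exp (|A| * (|t₀| + 1)))
      (fun i => by fun_prop) (hc.mul_right _) fun i t ht => ?_
    refine ((abs_re_le_norm _).trans (norm_mul_exp_le hA i t)).trans ?_
    have h1 : |t| ≤ |t₀| + 1 := by
      rw [Metric.mem_ball, Real.dist_eq] at ht
      have := abs_add_le (t - t₀) t₀
      rw [sub_add_cancel] at this
      linarith
    gcongr
    exact le_abs_self A
  exact hcont.continuousAt (Metric.ball_mem_nhds _ one_pos)

/-- Termwise integration is justified by the majorant `‖c i‖ e^{(A - Re w) t}`. -/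
lemma laplace_tsum_re_exp [Countable ι] (hc : Summable fun i => ‖c i‖)
    (hA : ∀ i, |(p i).re| ≤ A) {w : ℂ} (hw : A < w.re) :
    Integrable (fun t : ℝ => cexp (w * (-t : ℝ)) * ((∑' i, (c i * cexp (p i * t)).re : ℝ) : ℂ))
      (volume.restrict (Set.Ioi 0)) ∧
    ∫ t : ℝ in Set.Ioi 0, cexp (w * (-t : ℝ)) * ((∑' i, (c i * cexp (p i * t)).re : ℝ) : ℂ) =
      ∑' i, conjPole (c i) (p i) w := by
  have hpw : ∀ i, (p i).re < w.re := fun i => (le_abs_self _).trans_lt ((hA i).trans_lt hw)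
  have hg : IntegrableOn (fun t : ℝ => Real.exp ((A - w.re) * t)) (Set.Ioi 0) :=
    integrableOn_exp_mul_Ioi (by linarith) 0
  have hbound : ∀ i, ∀ᵐ t : ℝ ∂(volume.restrict (Set.Ioi 0)),
      ‖cexp (w * (-t : ℝ)) * (((c i * cexp (p i * t)).re : ℝ) : ℂ)‖ ≤
        ‖c i‖ * Real.exp ((A - w.re) * t) := fun i => by
    filter_upwards [ae_restrict_mem measurableSet_Ioi] with t ht
    have ht' : (0 : ℝ) < t := ht
    rw [norm_mul, norm_exp, norm_real, re_mul_ofReal, sub_mul, sub_eq_neg_add, Real.exp_add,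
      mul_left_comm, mul_neg]
    gcongr
    refine (abs_re_le_norm _).trans ((norm_mul_exp_le hA i t).trans_eq ?_)
    rw [abs_of_pos ht']
  have hS : ∀ t : ℝ, cexp (w * (-t : ℝ)) * ((∑' i, (c i * cexp (p i * t)).re : ℝ) : ℂ) =
      ∑' i, cexp (w * (-t : ℝ)) * (((c i * cexp (p i * t)).re : ℝ) : ℂ) := fun t => by
    rw [ofReal_tsum, tsum_mul_left]
  constructor
  · refine Integrable.mono' (hg.integrable.const_mul (∑' i, ‖c i‖)) ?_ ?_
    · refine Continuous.aestronglyMeasurable ?_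
      have := continuous_re_tsum_exp hc hA
      fun_prop
    · filter_upwards [ae_all_iff.2 hbound] with t ht
      rw [hS t, ← tsum_mul_right]
      exact tsum_of_norm_bounded (hc.mul_right _).hasSum ht
  · simp_rw [hS]
    rw [← (hasSum_integral_of_summable_integral_norm
      (fun i => integrable_laplace_re_exp (hpw i) (c i)) ?_).tsum_eq]
    · exact tsum_congr fun i => laplace_re_exp (hpw i) (c i)
    · refine Summable.of_nonneg_of_le (fun i => integral_nonneg fun t => norm_nonneg _) (fun i => ?_)
        (hc.mul_right (∫ t : ℝ in Set.Ioi 0, Real.exp ((A - w.re) * t)))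
      rw [← integral_const_mul]
      exact integral_mono_ae (integrable_laplace_re_exp (hpw i) (c i)).norm
        (hg.integrable.const_mul _) (hbound i)

lemma norm_conjPole_le {c p w : ℂ} {δ : ℝ} (hδ : 0 < δ) (h1 : δ ≤ ‖w - p‖)
    (h2 : δ ≤ ‖w - conj p‖) : ‖conjPole c p w‖ ≤ ‖c‖ / δ := by
  rw [conjPole, norm_div, RCLike.norm_ofNat, div_le_iff₀ (by norm_num)]
  refine (norm_add_le _ _).trans ?_
  rw [norm_div, norm_div, norm_conj]
  have h3 : ‖c‖ / ‖w - p‖ ≤ ‖c‖ / δ := by gcongr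
  have h4 : ‖c‖ / ‖w - conj p‖ ≤ ‖c‖ / δ := by gcongr
  linarith

/-- Near a point off the closed set `E` all denominators are bounded below, so summability of the
coefficients alone gives locally uniform convergence. -/
lemma differentiableOn_tsum_conjPole (hc : Summable fun i => ‖c i‖) {E : Set ℂ}
    (hE : IsClosed E) (hpE : ∀ i, p i ∈ E) (hpE' : ∀ i, conj (p i) ∈ E) :
    DifferentiableOn ℂ (fun w => ∑' i, conjPole (c i) (p i) w) Eᶜ := by
  intro w hw
  obtain ⟨ε, hε, hball⟩ := Metric.isOpen_iff.1 hE.isOpen_compl w hw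
  have hfar : ∀ q ∈ E, ∀ z ∈ Metric.ball w (ε / 2), ε / 2 ≤ ‖z - q‖ := fun q hq z hz => by
    have h1 : ε ≤ dist q w := not_lt.1 fun h => hball h hq
    rw [Metric.mem_ball] at hz
    have h2 := dist_triangle q z w
    rw [dist_comm q z] at h2
    rw [← dist_eq_norm]
    linarith
  have hd : DifferentiableOn ℂ (fun w => ∑' i, conjPole (c i) (p i) w) (Metric.ball w (ε / 2)) := by
    refine differentiableOn_tsum_of_summable_norm (u := fun i => ‖c i‖ / (ε / 2))
      (hc.div_const _) (fun i z hz => ?_) Metric.isOpen_ball fun i z hz =>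
        norm_conjPole_le (by positivity) (hfar _ (hpE i) z hz) (hfar _ (hpE' i) z hz)
    have h1 : z - p i ≠ 0 := norm_pos_iff.1 (by linarith [hfar _ (hpE i) z hz])
    have h2 : z - conj (p i) ≠ 0 := norm_pos_iff.1 (by linarith [hfar _ (hpE' i) z hz])
    unfold conjPole
    exact DifferentiableAt.differentiableWithinAt (by fun_prop (disch := assumption))
  exact ((hd w (Metric.mem_ball_self (by positivity))).differentiableAt
    (Metric.ball_mem_nhds _ (by positivity))).differentiableWithinAt

lemma tendsto_mul_div_sub (c p q : ℂ) :
    Tendsto (fun ε : ℝ => (ε : ℂ) * (c / (q + ε - p))) (𝓝[>] 0)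
      (𝓝 (if p = q then c else 0)) := by
  split_ifs with h
  · refine tendsto_const_nhds.congr' ?_
    filter_upwards [self_mem_nhdsWithin] with ε hε
    have hε' : (ε : ℂ) ≠ 0 := by
      have : (0 : ℝ) < ε := hε
      exact_mod_cast this.ne'
    rw [h, add_sub_cancel_left, mul_div_cancel₀ _ hε']
  · have hqp : q - p ≠ 0 := sub_ne_zero.2 (Ne.symm h)
    have hcont : ContinuousAt (fun ε : ℝ => (ε : ℂ) * (c / (q + ε - p))) 0 := by
      have h0 : q + ((0 : ℝ) : ℂ) - p ≠ 0 := by simpa using hqp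
      fun_prop (disch := assumption)
    have := hcont.tendsto
    simp only [ofReal_zero, zero_mul] at this
    exact this.mono_left nhdsWithin_le_nhds

/-- Reads off the residue at `q` along the ray from the right. The other points of `E` are at
distance at least `ρ` from `q`, hence more than `ε` from `q + ε` once `ε < ρ/2`; each term is then
dominated by `‖c i‖`. -/
lemma tendsto_mul_tsum_conjPole (hc : Summable fun i => ‖c i‖) {E : Set ℂ}
    (hpE : ∀ i, p i ∈ E) (hpE' : ∀ i, conj (p i) ∈ E) {q : ℂ}
    (hq : ∀ᶠ z in 𝓝[≠] q, z ∉ E) :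
    Tendsto (fun ε : ℝ => (ε : ℂ) * ∑' i, conjPole (c i) (p i) (q + ε)) (𝓝[>] 0)
      (𝓝 (∑' i, ((if p i = q then c i else 0) + (if conj (p i) = q then conj (c i) else 0)) / 2)) := by
  simp_rw [← tsum_mul_left]
  rw [eventually_nhdsWithin_iff, Metric.eventually_nhds_iff] at hq
  obtain ⟨ρ, hρ, hq⟩ := hq
  refine tendsto_tsum_of_dominated_convergence hc (fun i => ?_) ?_
  · have := ((tendsto_mul_div_sub (c i) (p i) q).add
      (tendsto_mul_div_sub (conj (c i)) (conj (p i)) q)).div_const 2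
    refine this.congr fun ε => ?_
    rw [conjPole]
    ring
  · have h1 : Set.Ioo (0 : ℝ) (ρ / 2) ∈ 𝓝[>] (0 : ℝ) := Ioo_mem_nhdsGT (by positivity)
    filter_upwards [h1] with ε hε i
    have hn : ‖(ε : ℂ)‖ = ε := by rw [norm_real, Real.norm_eq_abs, abs_of_pos hε.1]
    have hfar : ∀ e ∈ E, ε ≤ ‖q + ε - e‖ := fun e he => by
      rcases eq_or_ne e q with rfl | hne
      · rw [add_sub_cancel_left, hn]
      · have h2 : ρ ≤ dist e q := not_lt.1 fun h => hq h hne he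
        have h3 : ‖e - q‖ ≤ ‖q + ε - e‖ + ‖(ε : ℂ)‖ := by
          have := norm_sub_le (q + ε - e) (ε : ℂ)
          rwa [show q + ε - e - ε = -(e - q) by ring, norm_neg] at this
        rw [dist_eq_norm] at h2
        rw [hn] at h3
        linarith [hε.2]
    rw [norm_mul, hn]
    have := norm_conjPole_le (c := c i) hε.1 (hfar _ (hpE i)) (hfar _ (hpE' i))
    rw [le_div_iff₀ hε.1] at this
    linarith

end ExponentialSums

end ExtSelberg

/-! ### Vanishing of residues in the right half-plane -/

namespace ExtSelberg
open Complex Filter MeasureTheory ProbabilityTheory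

section

lemma Ioi_subset_integrableExpSet_restrict :
    Set.Ioi 0 ⊆ integrableExpSet (fun t : ℝ => -t) (volume.restrict (Set.Ioi 0)) := fun x hx => by
  have hx' : (0 : ℝ) < x := hx
  refine (integrableOn_exp_mul_Ioi (a := -x) (by linarith) 0).integrable.congr
    (ae_of_all _ fun t => ?_)
  show Real.exp (-x * t) = Real.exp (x * -t)
  ring_nf

lemma mem_interior_of_Ioi_subset {S : Set ℝ} {x₀ x : ℝ} (h : Set.Ioi x₀ ⊆ S) (hx : x₀ < x) :
    x ∈ interior S :=
  interior_mono h (by rw [interior_Ioi]; exact hx)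

/-- The Laplace transform of `t ^ 2` on `[0, ∞)`, written as an iterated derivative. -/
lemma laplace_sq {w : ℂ} (hw : 0 < w.re) :
    Integrable (fun t : ℝ => ((-t : ℝ) : ℂ) ^ 2 * cexp (w * (-t : ℝ)))
      (volume.restrict (Set.Ioi 0)) ∧
    ∫ t : ℝ in Set.Ioi 0, ((-t : ℝ) : ℂ) ^ 2 * cexp (w * (-t : ℝ)) =
      iteratedDeriv 2 (complexMGF (fun t : ℝ => -t) (volume.restrict (Set.Ioi 0))) w := by
  have hint := mem_interior_of_Ioi_subset Ioi_subset_integrableExpSet_restrict hw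
  refine ⟨?_, (iteratedDeriv_complexMGF hint 2).symm⟩
  refine (integrable_pow_abs_mul_exp_of_mem_interior_integrableExpSet hint 2).mono'
    (by fun_prop) (ae_of_all _ fun t => ?_)
  rw [norm_mul, norm_pow, norm_exp, norm_real, re_mul_ofReal, Real.norm_eq_abs]

/-- Supplies a pole whose horizontal ray to the right meets no other pole, so that analytic
continuation can run along that ray. -/
lemma exists_rightmost {E : Set ℂ} (hE : IsClosed E) {A : ℝ} (hA : ∀ e ∈ E, e.re ≤ A) {q : ℂ}
    (hq : q ∈ E) : ∃ q' ∈ E, q'.im = q.im ∧ q.re ≤ q'.re ∧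
      ∀ e ∈ E, e.im = q.im → e.re ≤ q'.re := by
  set Z : Set ℝ := {x | (x : ℂ) + q.im * I ∈ E}
  have hZc : IsClosed Z := hE.preimage (by fun_prop)
  have hqZ : q.re ∈ Z := by simpa [Z, re_add_im] using hq
  have hb : BddAbove Z := ⟨A, fun x hx => by simpa using hA _ hx⟩
  have hm : sSup Z ∈ Z := hZc.csSup_mem ⟨_, hqZ⟩ hb
  refine ⟨_, hm, by simp, by simpa using le_csSup hb hqZ, fun e he heq => ?_⟩
  have : e.re ∈ Z := by
    show (e.re : ℂ) + q.im * I ∈ E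
    rwa [← heq, re_add_im]
  simpa using le_csSup hb this

variable {ι : Type*} [Countable ι] {c p : ι → ℂ} {A : ℝ}

/-- If `a t² + b + Re ∑ cᵢ e^{pᵢ t}` is nonnegative on `[0, ∞)` and no exponent is a positive real
number, then the total coefficient of every exponent in `Re > 0` that is rightmost on its
horizontal line vanishes. -/
theorem tsum_residue_eq_zero (hc : Summable fun i => ‖c i‖) (hA0 : 0 ≤ A)
    (hA : ∀ i, |(p i).re| ≤ A)
    {E : Set ℂ} (hE : IsClosed E) (hpE : ∀ i, p i ∈ E) (hpE' : ∀ i, conj (p i) ∈ E)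
    (hEreal : ∀ x : ℝ, 0 < x → (x : ℂ) ∉ E) {a b : ℝ}
    (hpos : ∀ t : ℝ, 0 < t → 0 ≤ a * t ^ 2 + b + ∑' i, (c i * cexp (p i * t)).re)
    {q : ℂ} (hq0 : 0 < q.re) (hq : ∀ᶠ z in 𝓝[≠] q, z ∉ E)
    (hmax : ∀ e ∈ E, e.im = q.im → e.re ≤ q.re) :
    ∑' i, ((if p i = q then c i else 0) + (if conj (p i) = q then conj (c i) else 0)) / 2 = 0 := by
  set lam : Measure ℝ := volume.restrict (Set.Ioi 0)
  set f : ℝ → ℝ := fun t => a * t ^ 2 + b + ∑' i, (c i * cexp (p i * t)).re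
  have hfc : Continuous f := by
    have := continuous_re_tsum_exp hc hA
    fun_prop
  set g : ℝ → NNReal := fun t => (f t).toNNReal
  have hgm : Measurable g := hfc.measurable.real_toNNReal
  -- Nonnegativity of `f` enters here: it makes `f dt` a positive measure, and the truncation in `g`
  -- changes nothing on `t > 0`.
  set μ : Measure ℝ := lam.withDensity fun t => (g t : ENNReal)
  have hlam : ∀ᵐ t ∂lam, 0 < t := ae_restrict_mem measurableSet_Ioi
  have hgf : ∀ᵐ t ∂lam, (g t : ℝ) = f t := by
    filter_upwards [hlam] with t ht using Real.coe_toNNReal _ (hpos t ht)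
  have hμ : ∀ᵐ t ∂μ, 0 ≤ t :=
    (withDensity_absolutelyContinuous _ _).ae_le (hlam.mono fun t ht => le_of_lt ht)
  set L₀ := complexMGF (fun t : ℝ => -t) lam
  have hL₀ : ∀ w : ℂ, 0 < w.re → AnalyticAt ℂ L₀ w := fun w hw =>
    analyticAt_complexMGF (mem_interior_of_Ioi_subset Ioi_subset_integrableExpSet_restrict hw)
  -- The continuation of the Laplace transform of `f`. The first two terms are analytic in `Re w >
  -- 0`, so singularities there come only from the sum.
  set H : ℂ → ℂ := fun w => a * iteratedDeriv 2 L₀ w + b * L₀ w + ∑' i, conjPole (c i) (p i) w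
  have hH : ∀ w : ℂ, 0 < w.re → w ∉ E → AnalyticAt ℂ H w := fun w hw hwE => by
    have h1 : AnalyticAt ℂ (iteratedDeriv 2 L₀) w := by
      rw [iteratedDeriv_eq_iterate]
      exact (hL₀ w hw).iterated_deriv 2
    have h2 := (differentiableOn_tsum_conjPole hc hE hpE hpE').analyticAt
      (hE.isOpen_compl.mem_nhds hwE)
    exact ((analyticAt_const.mul h1).add (analyticAt_const.mul (hL₀ w hw))).add h2
  have hlap : ∀ w : ℂ, A < w.re →
      Integrable (fun t : ℝ => cexp (w * (-t : ℝ)) * (f t : ℂ)) lam ∧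
      ∫ t, cexp (w * (-t : ℝ)) * (f t : ℂ) ∂lam = H w := by
    intro w hw
    have hw0 : 0 < w.re := hA0.trans_lt hw
    obtain ⟨i1, e1⟩ := laplace_sq hw0
    obtain ⟨i3, e3⟩ := laplace_tsum_re_exp hc hA hw
    have i2 : Integrable (fun t : ℝ => cexp (w * (-t : ℝ))) lam :=
      ((integrable_exp_mul_neg_mul_exp (p := 0) (w := w) (by simpa using hw0) 1).congr
        (ae_of_all _ fun t => by simp))
    have i12 : Integrable (fun t : ℝ => a * (((-t : ℝ) : ℂ) ^ 2 * cexp (w * (-t : ℝ))) +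
        b * cexp (w * (-t : ℝ))) lam := (i1.const_mul _).add (i2.const_mul _)
    have e2 : ∫ t : ℝ, cexp (w * (-t : ℝ)) ∂lam = L₀ w := rfl
    have hsplit : ∀ t : ℝ, cexp (w * (-t : ℝ)) * (f t : ℂ) =
        a * (((-t : ℝ) : ℂ) ^ 2 * cexp (w * (-t : ℝ))) + b * cexp (w * (-t : ℝ)) +
          cexp (w * (-t : ℝ)) * ((∑' i, (c i * cexp (p i * t)).re : ℝ) : ℂ) := fun t => by
      simp only [f]
      push_cast
      ring
    simp_rw [hsplit]
    refine ⟨i12.add i3, ?_⟩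
    rw [integral_add i12 i3, integral_add (i1.const_mul _) (i2.const_mul _), integral_const_mul,
      integral_const_mul, e1, e2, e3]
  have hMGF : ∀ w : ℂ, A < w.re → complexMGF (fun t : ℝ => -t) μ w = H w := fun w hw => by
    rw [← (hlap w hw).2, complexMGF, integral_withDensity_eq_integral_smul hgm]
    refine integral_congr_ae ?_
    filter_upwards [hgf] with t ht
    rw [NNReal.smul_def, ht, real_smul, mul_comm]
  have hint : ∀ x : ℝ, A < x → x ∈ integrableExpSet (fun t : ℝ => -t) μ := fun x hx => by
    refine (integrable_withDensity_iff_integrable_coe_smul hgm).2 ?_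
    refine ((hlap x (by simpa using hx)).1.re).congr ?_
    filter_upwards [hgf] with t ht
    rw [ht, smul_eq_mul]
    have : cexp (x * (-t : ℝ)) * (f t : ℂ) = ((f t * Real.exp (x * -t) : ℝ) : ℂ) := by
      push_cast
      ring
    rw [this]
    rfl
  have hall := Ioi_subset_integrableExpSet_of_analyticAt hμ hint (H := H)
    (fun x hx => hH x (by simpa using hx) (hEreal x hx))
    (fun x hx => (hMGF x (by simpa using hx)).symm)
  have hLan : ∀ w : ℂ, 0 < w.re → AnalyticAt ℂ (complexMGF (fun t : ℝ => -t) μ) w := fun w hw =>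
    analyticAt_complexMGF (mem_interior_of_Ioi_subset hall hw)
  have hray : ∀ ε : ℝ, 0 < ε → q + ε ∉ E := fun ε hε he => by
    have := hmax _ he (by simp)
    simp at this
    linarith
  -- The two sides agree for `Re w > A`. The open ray from `q` reaches that region while avoiding
  -- `E`, so the identity theorem carries the equality back towards `q`.
  have hEq : Set.EqOn H (complexMGF (fun t : ℝ => -t) μ)
      ((fun ε : ℝ => q + ε) '' Set.Ioi 0) := by
    refine AnalyticOnNhd.eqOn_of_preconnected_of_eventuallyEq (𝕜 := ℂ)
      (z₀ := q + (A + 1 : ℝ)) ?_ ?_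
      (isPreconnected_Ioi.image _ (by fun_prop)) ⟨A + 1, by simp; linarith, rfl⟩ ?_
    · rintro _ ⟨ε, hε, rfl⟩
      have hε' : 0 < ε := hε
      exact hH _ (by simp; linarith) (hray ε hε')
    · rintro _ ⟨ε, hε, rfl⟩
      have hε' : 0 < ε := hε
      exact hLan _ (by simp; linarith)
    · have hopen : IsOpen {w : ℂ | A < w.re} := isOpen_lt continuous_const continuous_re
      have hmem : q + (A + 1 : ℝ) ∈ {w : ℂ | A < w.re} := by
        show A < (q + (A + 1 : ℝ)).re
        simp
        linarith
      filter_upwards [hopen.mem_nhds hmem] with w hw using (hMGF w hw).symm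
  have hreg : ∀ h : ℂ → ℂ, ContinuousAt h q →
      Tendsto (fun ε : ℝ => (ε : ℂ) * h (q + ε)) (𝓝[>] 0) (𝓝 0) := fun h hh => by
    have h1 : Tendsto (fun ε : ℝ => q + (ε : ℂ)) (𝓝 0) (𝓝 q) := by
      have : Continuous fun ε : ℝ => q + (ε : ℂ) := by fun_prop
      simpa using this.tendsto 0
    have h2 : Tendsto (fun ε : ℝ => (ε : ℂ)) (𝓝 0) (𝓝 0) := by
      simpa using continuous_ofReal.tendsto 0
    have := h2.mul (hh.tendsto.comp h1)
    rw [zero_mul] at this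
    exact this.mono_left nhdsWithin_le_nhds
  have hres := tendsto_mul_tsum_conjPole hc hpE hpE' hq
  have hD2 : ContinuousAt (iteratedDeriv 2 L₀) q := by
    rw [iteratedDeriv_eq_iterate]
    exact ((hL₀ q hq0).iterated_deriv 2).continuousAt
  -- By Landau the transform is analytic at `q`; after removing the regular terms, `ε` times it
  -- tends to `0`, whereas the same quantity tends to the residue.
  have hzero := hreg (fun w => complexMGF (fun t : ℝ => -t) μ w
      - (a * iteratedDeriv 2 L₀ w + b * L₀ w))
    ((hLan q hq0).continuousAt.sub ((continuousAt_const.mul hD2).add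
      (continuousAt_const.mul (hL₀ q hq0).continuousAt)))
  refine tendsto_nhds_unique hres (hzero.congr' ?_)
  filter_upwards [self_mem_nhdsWithin] with ε hε
  rw [← hEq ⟨ε, hε, rfl⟩]
  simp only [H]
  ring

end

end ExtSelberg

/-! ### The screw function as an exponential sum -/

namespace ExtSelberg
open Complex Filter

section

variable {D : FEData} {F : ℂ → ℂ}

lemma logDeriv_xi_reflect (hD : SatisfiesFE D F) (hX : Differentiable ℂ (xi D F)) (s : ℂ) :
    logDeriv (xi D F) (1 - conj s) = -conj (logDeriv (xi D F) s) := by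
  have key : ∀ s, logDeriv (xi D F) s = -conj (logDeriv (xi D F) (1 - conj s)) := fun s => by
    have hω : D.omega ≠ 0 := norm_ne_zero_iff.1 (by rw [D.norm_omega]; exact one_ne_zero)
    have h1 : HasDerivAt (fun z => xi D F (1 - z)) (-deriv (xi D F) (1 - conj s)) (conj s) := by
      have := (hX (1 - conj s)).hasDerivAt.comp_const_sub 1 (conj s)
      exact this
    have h2 := h1.conj_conj
    rw [conj_conj] at h2
    have h3 : xi D F = fun z => D.omega * (conj ∘ (fun z => xi D F (1 - z)) ∘ conj) z :=
      funext fun z => hD z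
    have h4 : deriv (xi D F) s = D.omega * conj (-deriv (xi D F) (1 - conj s)) := by
      conv_lhs => rw [h3]
      exact (h2.const_mul D.omega).deriv
    rw [logDeriv_apply, logDeriv_apply, h4]
    conv_lhs => rw [hD s]
    rw [mul_div_mul_left _ _ hω, map_neg, map_div₀, neg_div]
  have := key (1 - conj s)
  simpa using this

lemma zeroMult_zero :
    zeroMult D F 0 = analyticOrderNatAt (xi D F) (1 / 2) := by
  have hd : deriv (fun z : ℂ => 1 / 2 - I * z) 0 ≠ 0 := by
    have : HasDerivAt (fun z : ℂ => 1 / 2 - I * z) (-(I * 1)) 0 :=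
      ((hasDerivAt_id (0 : ℂ)).const_mul I).const_sub _
    rw [this.deriv]
    simp
  have h := analyticOrderAt_comp_of_deriv_ne_zero (f := xi D F)
    (g := fun z : ℂ => 1 / 2 - I * z) (z₀ := 0) (by fun_prop) hd
  simp only [mul_zero, sub_zero] at h
  rw [zeroMult, analyticOrderNatAt, analyticOrderNatAt, ← h]
  rfl

/-- The regularised logarithmic derivative satisfies `φ (1 - conj s) = -conj (φ s)` and `1/2` is
fixed by the reflection, so its limit `L` satisfies `L = -conj L`. Factoring out `(s - 1/2)^{m_0}`
shows that the limit exists. -/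
lemma iB_re (hD : SatisfiesFE D F) (hX : Differentiable ℂ (xi D F)) {z : ℂ}
    (hz : xi D F z ≠ 0) : (iB D F).re = 0 := by
  set φ : ℂ → ℂ := fun s => logDeriv (xi D F) s - (zeroMult D F 0 : ℂ) / (s - 1 / 2)
  have hord : analyticOrderAt (xi D F) (1 / 2) ≠ ⊤ := fun h => by
    rw [analyticOrderAt_eq_top] at h
    have h1 := (h.filter_mono nhdsWithin_le_nhds).and
      (eventually_ne_zero_punctured hX hz (1 / 2))
    obtain ⟨w, hw, hw'⟩ := h1.exists
    exact hw' hw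
  obtain ⟨g, hg, hg0, hgX⟩ := ((hX.analyticAt (1 / 2)).analyticOrderNatAt_eq_iff hord
    (n := zeroMult D F 0)).1 zeroMult_zero.symm
  have hφ : φ =ᶠ[𝓝[≠] (1 / 2 : ℂ)] logDeriv g := by
    have h1 := eventually_eventually_nhds.2 hgX
    have h2 : ∀ᶠ s in 𝓝 (1 / 2 : ℂ), g s ≠ 0 := hg.continuousAt.eventually_ne hg0
    filter_upwards [h1.filter_mono nhdsWithin_le_nhds, h2.filter_mono nhdsWithin_le_nhds,
      hg.eventually_analyticAt.filter_mono nhdsWithin_le_nhds, self_mem_nhdsWithin]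
      with s hs1 hs2 hs3 hs4
    have hs4' : s - 1 / 2 ≠ 0 := sub_ne_zero.2 hs4
    have hs1' : xi D F =ᶠ[𝓝 s] fun z => (z - 1 / 2) ^ zeroMult D F 0 * g z := hs1
    have h3 : logDeriv (xi D F) s =
        logDeriv (fun z => (z - 1 / 2) ^ zeroMult D F 0 * g z) s := by
      rw [logDeriv_apply, logDeriv_apply, hs1'.deriv_eq, hs1'.eq_of_nhds]
    have h4 : logDeriv (fun z : ℂ => z - 1 / 2) s = 1 / (s - 1 / 2) := by
      rw [logDeriv_apply, deriv_sub_const, deriv_id'']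
    simp only [φ]
    rw [h3, logDeriv_mul (f := fun z : ℂ => (z - 1 / 2) ^ zeroMult D F 0) s
      (pow_ne_zero _ hs4') hs2 (by fun_prop) hs3.differentiableAt,
      logDeriv_fun_pow (by fun_prop), h4]
    ring
  have hlim : Tendsto φ (𝓝[≠] (1 / 2 : ℂ)) (𝓝 (logDeriv g (1 / 2))) := by
    refine Tendsto.congr' hφ.symm ?_
    have : ContinuousAt (logDeriv g) (1 / 2) := (hg.deriv.continuousAt).div hg.continuousAt hg0
    exact this.tendsto.mono_left nhdsWithin_le_nhds
  have hiB : iB D F = logDeriv g (1 / 2) := hlim.limUnder_eq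
  have hrefl : Tendsto (fun s : ℂ => 1 - conj s) (𝓝[≠] (1 / 2)) (𝓝[≠] (1 / 2)) := by
    refine tendsto_nhdsWithin_of_tendsto_nhds_of_eventually_within _ ?_ ?_
    · have : Continuous fun s : ℂ => 1 - conj s := by fun_prop
      have h := this.tendsto (1 / 2)
      have h' : (1 : ℂ) - conj (1 / 2) = 1 / 2 := by
        rw [map_div₀, map_one, map_ofNat]
        norm_num
      rw [h'] at h
      exact h.mono_left nhdsWithin_le_nhds
    · filter_upwards [self_mem_nhdsWithin] with s hs h
      apply hs
      have h1 : 1 - conj s = 1 / 2 := h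
      have h2 : conj s = 1 / 2 := by linear_combination -h1
      have h3 := congrArg conj h2
      rwa [conj_conj, map_div₀, map_one, map_ofNat] at h3
  have hφr : ∀ s, φ (1 - conj s) = -conj (φ s) := fun s => by
    simp only [φ]
    rw [logDeriv_xi_reflect hD hX, map_sub, map_div₀, map_sub, map_div₀, map_one, map_natCast,
      map_ofNat]
    have : (1 : ℂ) - conj s - 1 / 2 = -(conj s - 1 / 2) := by ring
    rw [this, div_neg]
    ring
  have h1 := hlim.comp hrefl
  have h2 : Tendsto (φ ∘ fun s : ℂ => 1 - conj s) (𝓝[≠] (1 / 2))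
      (𝓝 (-conj (logDeriv g (1 / 2)))) := by
    have := ((continuous_conj.tendsto _).comp hlim).neg
    exact this.congr fun s => (hφr s).symm
  have h3 := congrArg re (tendsto_nhds_unique h1 h2)
  rw [hiB]
  rw [neg_re, conj_re] at h3
  linarith

/-- The pole `-iγ` of the Laplace transform of the screw function attached to the zero `γ`. -/
noncomputable def pole (D : FEData) (F : ℂ → ℂ) (γ : ↥(nontrivialZeros D F \ {0})) : ℂ := -I * γ

/-- The coefficient of `e^{-iγt}` in `-g_F`. -/
noncomputable def poleCoeff (D : FEData) (F : ℂ → ℂ) (γ : ↥(nontrivialZeros D F \ {0})) : ℂ :=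
  (zeroMult D F γ : ℂ) / pole D F γ ^ 2

lemma screwTerm_eq (t : ℝ) (γ : ↥(nontrivialZeros D F \ {0})) :
    screwTerm D F t γ = poleCoeff D F γ - poleCoeff D F γ * cexp (pole D F γ * t) := by
  have h : (-I * (γ : ℂ)) ^ 2 = -(γ : ℂ) ^ 2 := by rw [mul_pow, neg_sq, I_sq]; ring
  rw [screwTerm, poleCoeff, pole, h, div_neg]
  ring

lemma expGrowth_xi_rotated (h : ExpGrowth Set.univ (3 / 2) (xi D F)) :
    ExpGrowth Set.univ (3 / 2) (fun z => xi D F (1 / 2 - I * z)) := by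
  obtain ⟨C, hC, h⟩ := h
  refine ⟨C * 2 ^ (3 / 2 : ℝ), by positivity, fun z _ => (h _ (Set.mem_univ _)).trans ?_⟩
  rw [mul_assoc, ← Real.mul_rpow (by norm_num) (by positivity)]
  gcongr
  have := norm_sub_le (1 / 2 : ℂ) (I * z)
  rw [norm_mul, norm_I, one_mul] at this
  norm_num at this
  linarith [norm_nonneg z]

lemma summable_norm_poleCoeff (hX : Differentiable ℂ (xi D F))
    (h : ExpGrowth Set.univ (3 / 2) (xi D F)) (h2 : xi D F 2 ≠ 0) :
    Summable fun γ => ‖poleCoeff D F γ‖ := by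
  have hs := summable_order_div_sq (f := fun z => xi D F (1 / 2 - I * z)) (by fun_prop)
    -- The point `z = 3i/2` corresponds to `s = 2`, where `xi` does not vanish.
    (expGrowth_xi_rotated h) (c := 3 / 2 * I) (by
      have : 1 / 2 - I * (3 / 2 * I) = 2 := by linear_combination (-3 / 2 : ℂ) * I_mul_I
      rwa [this])
  refine (hs.comp_injective (Subtype.val_injective
    (p := fun γ => γ ∈ nontrivialZeros D F \ {0}))).congr fun γ => ?_
  simp [poleCoeff, pole, zeroMult]

lemma zeroMult_pos (hX : Differentiable ℂ (xi D F)) (h2 : xi D F 2 ≠ 0) {γ : ℂ}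
    (hγ : γ ∈ nontrivialZeros D F) : 0 < zeroMult D F γ := by
  have hd : Differentiable ℂ fun z => xi D F (1 / 2 - I * z) := by fun_prop
  have hc : xi D F (1 / 2 - I * (3 / 2 * I)) ≠ 0 := by
    have : 1 / 2 - I * (3 / 2 * I) = 2 := by linear_combination (-3 / 2 : ℂ) * I_mul_I
    rwa [this]
  have htop : analyticOrderAt (fun z => xi D F (1 / 2 - I * z)) γ ≠ ⊤ := fun h => by
    rw [analyticOrderAt_eq_top] at h
    have h1 := (h.filter_mono nhdsWithin_le_nhds).and
      (eventually_ne_zero_punctured hd (c := 3 / 2 * I) hc γ)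
    obtain ⟨w, hw, hw'⟩ := h1.exists
    exact hw' hw
  rw [Nat.pos_iff_ne_zero, zeroMult, Ne, ← Nat.cast_eq_zero (R := ℕ∞),
    Nat.cast_analyticOrderNatAt htop, (hd.analyticAt γ).analyticOrderAt_eq_zero, not_not]
  exact hγ

lemma neg_screw_re (hB : (iB D F).re = 0) {t : ℝ} (ht : 0 ≤ t)
    (hs : Summable fun γ : ↥(nontrivialZeros D F \ {0}) => screwTerm D F t γ) :
    (-screw D F t).re = (zeroMult D F 0 : ℝ) / 2 * t ^ 2
      + ∑' γ : ↥(nontrivialZeros D F \ {0}), (-screwTerm D F t γ).re := by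
  have h1 : (-iB D F * t).re = 0 := by rw [re_mul_ofReal, neg_re, hB]; simp
  have h2 : ((zeroMult D F 0 : ℂ) / 2 * (t : ℂ) ^ 2) =
      (((zeroMult D F 0 : ℝ) / 2 * t ^ 2 : ℝ) : ℂ) := by push_cast; rfl
  rw [screw, if_pos ht, screwFormula, h2, neg_re, add_re, sub_re, h1, ofReal_re, re_tsum hs]
  simp only [neg_re]
  rw [tsum_neg]
  ring

/-- For real `γ` the quantity is `m_γ (1 - cos γt) / γ²`. -/
lemma neg_screwTerm_re_nonneg {γ : ℂ} (hγ : γ.im = 0) (t : ℝ) :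
    0 ≤ (-screwTerm D F t γ).re := by
  obtain ⟨x, rfl⟩ : ∃ x : ℝ, γ = x := ⟨γ.re, (ext (by simp) (by simp [hγ]))⟩
  have h1 : -screwTerm D F t x =
      (((zeroMult D F x : ℝ) / x ^ 2 : ℝ) : ℂ) * (1 - cexp (((-(x * t) : ℝ) : ℂ) * I)) := by
    rw [screwTerm, show -I * (x : ℂ) * t = ((-(x * t) : ℝ) : ℂ) * I by push_cast; ring]
    push_cast
    ring
  rw [h1, re_ofReal_mul, sub_re, one_re, exp_ofReal_mul_I_re]
  exact mul_nonneg (by positivity) (by linarith [Real.cos_le_one (-(x * t))])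

end

end ExtSelberg

/-! ### From nonnegativity to GRH -/

namespace ExtSelberg
open Complex Filter

section

variable {D : FEData} {F : ℂ → ℂ}

/-- The poles of the Laplace transform of `Re g_F`: shifted zeros and their conjugates. -/
def poleSet (D : FEData) (F : ℂ → ℂ) : Set ℂ :=
  {w | xi D F (1 / 2 + w) = 0 ∨ xi D F (1 / 2 + conj w) = 0}

lemma isClosed_poleSet (hX : Differentiable ℂ (xi D F)) : IsClosed (poleSet D F) := by
  have hc := hX.continuous
  exact (isClosed_eq (by fun_prop) continuous_const).union
    (isClosed_eq (by fun_prop) continuous_const)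

lemma pole_mem_poleSet (γ : ↥(nontrivialZeros D F \ {0})) :
    pole D F γ ∈ poleSet D F ∧ conj (pole D F γ) ∈ poleSet D F := by
  have h : xi D F (1 / 2 + pole D F γ) = 0 := by
    have h0 : xi D F (1 / 2 - I * γ) = 0 := γ.2.1
    rwa [pole, neg_mul, ← sub_eq_add_neg]
  exact ⟨Or.inl h, Or.inr (by rwa [conj_conj])⟩

lemma eventually_notMem_poleSet (hX : Differentiable ℂ (xi D F)) (h2 : xi D F 2 ≠ 0) (q : ℂ) :
    ∀ᶠ z in 𝓝[≠] q, z ∉ poleSet D F := by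
  have hd : Differentiable ℂ fun w => xi D F (1 / 2 + w) := by fun_prop
  have hc : xi D F (1 / 2 + 3 / 2) ≠ 0 := by norm_num [h2]
  have hconj : Tendsto (fun z : ℂ => conj z) (𝓝[≠] q) (𝓝[≠] (conj q)) := by
    refine tendsto_nhdsWithin_of_tendsto_nhds_of_eventually_within _
      ((continuous_conj.tendsto q).mono_left nhdsWithin_le_nhds) ?_
    filter_upwards [self_mem_nhdsWithin] with z hz h
    exact hz ((starRingEnd ℂ).injective h)
  filter_upwards [eventually_ne_zero_punctured hd hc q,
    hconj.eventually (eventually_ne_zero_punctured hd hc (conj q))] with z h1 h2 h3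
  exact h3.elim h1 h2

lemma abs_re_le_of_mem_poleSet {A : ℝ} (hA : ∀ s : ℂ, xi D F s = 0 → |s.re - 1 / 2| ≤ A)
    {e : ℂ} (he : e ∈ poleSet D F) : |e.re| ≤ A := by
  rcases he with he | he
  · simpa using hA _ he
  · simpa using hA _ he

lemma tsum_neg_screwTerm_re (hc : Summable fun γ => ‖poleCoeff D F γ‖) {t : ℝ}
    (hexp : Summable fun γ => poleCoeff D F γ * cexp (pole D F γ * t)) :
    ∑' γ : ↥(nontrivialZeros D F \ {0}), (-screwTerm D F t γ).re =
      ∑' γ, (poleCoeff D F γ * cexp (pole D F γ * t)).re - ∑' γ, (poleCoeff D F γ).re := by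
  rw [← re_tsum hexp, ← re_tsum hc.of_norm, ← sub_re, ← hexp.tsum_sub hc.of_norm,
    re_tsum (hexp.sub hc.of_norm)]
  exact tsum_congr fun γ => by rw [screwTerm_eq, neg_sub]

/-- The residues cannot cancel: every `γ` contributing at `q`, directly or through its conjugate,
does so with a positive multiple of `1 / q²`. -/
lemma GRH_of_nonneg (hD : SatisfiesFE D F)
    (hreal : ∀ σ : ℝ, xi D F (σ : ℂ) = 0 → σ = 1 / 2) (hX : Differentiable ℂ (xi D F))
    (hc : Summable fun γ => ‖poleCoeff D F γ‖) {A : ℝ} (hA0 : 0 ≤ A)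
    (hA : ∀ s : ℂ, xi D F s = 0 → |s.re - 1 / 2| ≤ A) {a b : ℝ}
    (hpos : ∀ t : ℝ, 0 < t → 0 ≤ a * t ^ 2 + b +
      ∑' γ, (poleCoeff D F γ * cexp (pole D F γ * t)).re) : GRH D F := by
  have h2 : xi D F 2 ≠ 0 := fun h => by
    have := hreal 2 (by exact_mod_cast h)
    norm_num at this
  have hEre : ∀ e ∈ poleSet D F, |e.re| ≤ A := fun e he => abs_re_le_of_mem_poleSet hA he
  have hpA : ∀ γ, |(pole D F γ).re| ≤ A := fun γ => hEre _ (pole_mem_poleSet γ).1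
  have hEreal : ∀ x : ℝ, 0 < x → (x : ℂ) ∉ poleSet D F := fun x hx he => by
    have h : xi D F ((1 / 2 + x : ℝ) : ℂ) = 0 := by
      rcases he with he | he
      · push_cast; exact he
      · rw [conj_ofReal] at he; push_cast; exact he
    linarith [hreal _ h]
  have hγ0 : ∀ γ : ↥(nontrivialZeros D F \ {0}), pole D F γ ≠ 0 := fun γ =>
    mul_ne_zero (neg_ne_zero.2 I_ne_zero) γ.2.2
  -- A summable family has countable support, and no coefficient vanishes because every zero has
  -- positive multiplicity.
  have hcount : Countable ↥(nontrivialZeros D F \ {0}) := by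
    have h := hc.countable_support
    have : Function.support (fun γ => ‖poleCoeff D F γ‖) = Set.univ := by
      refine Set.eq_univ_of_forall fun γ => ?_
      rw [Function.mem_support, norm_ne_zero_iff]
      exact div_ne_zero (by exact_mod_cast (zeroMult_pos hX h2 γ.2.1).ne') (pow_ne_zero _ (hγ0 γ))
    rwa [this, Set.countable_univ_iff] at h
  have key : ∀ q₀ ∈ poleSet D F, q₀.re ≤ 0 := by
    intro q₀ hq₀
    by_contra! hpos₀
    obtain ⟨q, hqE, him, hre, hmax⟩ := exists_rightmost (isClosed_poleSet hX)
      (fun e he => (le_abs_self _).trans (hEre e he)) hq₀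
    have hq0 : 0 < q.re := hpos₀.trans_le hre
    have hqne : q ≠ 0 := by rintro rfl; simp at hq0
    have hres := tsum_residue_eq_zero hc hA0 hpA (isClosed_poleSet hX)
      (fun γ => (pole_mem_poleSet γ).1) (fun γ => (pole_mem_poleSet γ).2) hEreal hpos hq0
      (eventually_notMem_poleSet hX h2 q) (by rwa [him])
    classical
    -- The residue contribution of `γ` multiplied by `q²`, a nonnegative real since `conj (m / p²) =
    -- m / q²` when `conj p = q`.
    let r : ↥(nontrivialZeros D F \ {0}) → ℝ := fun γ => (zeroMult D F γ : ℝ) *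
      ((if pole D F γ = q then 1 else 0) + (if conj (pole D F γ) = q then 1 else 0)) / 2
    have hr0 : ∀ γ, 0 ≤ r γ := fun γ => by positivity
    have hrρ : ∀ γ, ((if pole D F γ = q then poleCoeff D F γ else 0) +
        (if conj (pole D F γ) = q then conj (poleCoeff D F γ) else 0)) / 2 =
        (r γ : ℂ) / q ^ 2 := fun γ => by
      have e1 : (if pole D F γ = q then poleCoeff D F γ else 0) =
          (zeroMult D F γ : ℂ) * (if pole D F γ = q then 1 else 0) / q ^ 2 := by
        split_ifs with h
        · rw [poleCoeff, h, mul_one]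
        · simp
      have e2 : (if conj (pole D F γ) = q then conj (poleCoeff D F γ) else 0) =
          (zeroMult D F γ : ℂ) * (if conj (pole D F γ) = q then 1 else 0) / q ^ 2 := by
        split_ifs with h
        · rw [poleCoeff, map_div₀, map_pow, h, map_natCast, mul_one]
        · simp
      rw [e1, e2]
      simp only [r]
      split_ifs <;> push_cast <;> ring
    simp_rw [hrρ] at hres
    rw [tsum_div_const, div_eq_zero_iff, or_iff_left (pow_ne_zero _ hqne), ← ofReal_tsum,
      ofReal_eq_zero] at hres
    have hrs : Summable r := by
      refine Summable.of_nonneg_of_le hr0 (fun γ => ?_) (hc.mul_right (‖q‖ ^ 2))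
      have h1 : ‖(r γ : ℂ) / q ^ 2‖ ≤ ‖poleCoeff D F γ‖ := by
        rw [← hrρ γ, norm_div, RCLike.norm_ofNat, div_le_iff₀ (by norm_num)]
        refine (norm_add_le _ _).trans ?_
        have : ‖(if pole D F γ = q then poleCoeff D F γ else 0)‖ ≤ ‖poleCoeff D F γ‖ := by
          split_ifs <;> simp
        have : ‖(if conj (pole D F γ) = q then conj (poleCoeff D F γ) else 0)‖ ≤
            ‖poleCoeff D F γ‖ := by
          split_ifs <;> simp
        linarith
      rwa [norm_div, norm_pow, div_le_iff₀ (by positivity), norm_real, Real.norm_eq_abs,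
        abs_of_nonneg (hr0 γ)] at h1
    have hall := (hasSum_zero_iff_of_nonneg hr0).1 (hres ▸ hrs.hasSum)
    have hex : ∃ γ : ↥(nontrivialZeros D F \ {0}), pole D F γ = q ∨ conj (pole D F γ) = q := by
      rcases hqE with h | h
      · refine ⟨⟨I * q, ?_, mul_ne_zero I_ne_zero hqne⟩, Or.inl ?_⟩
        · show xi D F (1 / 2 - I * (I * q)) = 0
          rwa [← mul_assoc, I_mul_I, neg_one_mul, sub_neg_eq_add]
        · show -I * (I * q) = q
          rw [← mul_assoc, neg_mul, I_mul_I, neg_neg, one_mul]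
      · refine ⟨⟨I * conj q, ?_, mul_ne_zero I_ne_zero (by simpa using hqne)⟩, Or.inr ?_⟩
        · show xi D F (1 / 2 - I * (I * conj q)) = 0
          rwa [← mul_assoc, I_mul_I, neg_one_mul, sub_neg_eq_add]
        · show conj (-I * (I * conj q)) = q
          rw [← mul_assoc, neg_mul, I_mul_I, neg_neg, one_mul, conj_conj]
    obtain ⟨γ, hγ⟩ := hex
    have hm : (0 : ℝ) < zeroMult D F γ := by exact_mod_cast zeroMult_pos hX h2 γ.2.1
    have hzero : r γ = 0 := congrFun hall γ
    have hrpos : 0 < r γ := by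
      simp only [r]
      rcases hγ with h | h
      · rw [if_pos h]; positivity
      · rw [if_pos h]; positivity
    linarith
  -- Apply the half-plane bound to `s` and to its mirror zero `1 - conj s`.
  intro s hs
  have h1 := key (s - 1 / 2) (Or.inl (by rwa [add_sub_cancel]))
  have h3 : xi D F (1 - conj s) = 0 := norm_eq_zero.1 (by rw [← norm_xi_reflect hD, hs, norm_zero])
  have h4 := key (1 - conj s - 1 / 2) (Or.inl (by rwa [add_sub_cancel]))
  simp at h1 h4
  linarith

end

end ExtSelberg

/-! ### The main theorem -/

open ExtSelberg in
theorem theorem1p1 (F : ℂ → ℂ) (hF : F ∈ ExtSelberg.ExtendedSelbergClass)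
    (D : ExtSelberg.FEData) (hD : ExtSelberg.SatisfiesFE D F)
    (hreal : ∀ σ : ℝ, ExtSelberg.xi D F (σ : ℂ) = 0 → σ = 1 / 2) :
    (∀ t : ℝ, Summable fun γ : ↥(ExtSelberg.nontrivialZeros D F \ {0}) =>
        ExtSelberg.screwTerm D F t γ) ∧
      (ExtSelberg.GRH D F ↔
        ∃ t₀ : ℝ, 0 ≤ t₀ ∧ ∀ t : ℝ, t₀ ≤ t → 0 ≤ (-ExtSelberg.screw D F t).re) := by
  obtain ⟨G, hG, hGF⟩ := exists_entire_of_mem F hF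
  have hX := xi_differentiable hD hG.1 hGF
  have h2 : xi D F 2 ≠ 0 := fun h => by
    have := hreal 2 (by exact_mod_cast h)
    norm_num at this
  obtain ⟨A, hA0, hA⟩ := xi_zeros_in_strip hF.1 hD hG.1 hGF h2
  have hc := summable_norm_poleCoeff hX (xi_expGrowth hF.1 hD hG hGF) h2
  have hB := iB_re hD hX h2
  have hpA : ∀ γ, |(pole D F γ).re| ≤ A := fun γ =>
    abs_re_le_of_mem_poleSet hA (pole_mem_poleSet γ).1
  have hexp := fun t : ℝ => summable_mul_exp hc hpA t
  have hsum : ∀ t : ℝ, Summable fun γ : ↥(nontrivialZeros D F \ {0}) => screwTerm D F t γ :=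
    fun t => (hc.of_norm.sub (hexp t)).congr fun γ => (screwTerm_eq t γ).symm
  refine ⟨hsum, fun hGRH => ⟨0, le_rfl, fun t ht => ?_⟩, ?_⟩
  · rw [neg_screw_re hB ht (hsum t)]
    refine add_nonneg (by positivity) (tsum_nonneg fun γ => neg_screwTerm_re_nonneg ?_ t)
    have h := hGRH _ γ.2.1
    simpa using h
  · rintro ⟨t₀, ht₀, hnonneg⟩
    set S := ∑' γ, ‖poleCoeff D F γ‖
    have hS : 0 ≤ S := tsum_nonneg fun _ => norm_nonneg _
    set b := -∑' γ, (poleCoeff D F γ).re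
    have hscrew : ∀ t : ℝ, 0 ≤ t → (-screw D F t).re = (zeroMult D F 0 : ℝ) / 2 * t ^ 2 + b +
        ∑' γ, (poleCoeff D F γ * Complex.exp (pole D F γ * t)).re := fun t ht => by
      rw [neg_screw_re hB ht (hsum t), tsum_neg_screwTerm_re hc (hexp t), sub_eq_neg_add,
        add_assoc]
    have hbound : ∀ t : ℝ, |∑' γ, (poleCoeff D F γ * Complex.exp (pole D F γ * t)).re| ≤
        S * Real.exp (A * |t|) := fun t => by
      rw [← Real.norm_eq_abs]
      exact tsum_of_norm_bounded (hc.hasSum.mul_right _) fun γ =>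
        (Complex.abs_re_le_norm _).trans (norm_mul_exp_le hpA γ t)
    -- The added constant `|b| + S e^{A t₀}` outweighs the negative part on `(0, t₀]`. A constant
    -- affects the Laplace transform only through a pole at `w = 0`, outside `Re w > 0`.
    refine GRH_of_nonneg hD hreal hX hc hA0 hA (a := (zeroMult D F 0 : ℝ) / 2)
      (b := b + (|b| + S * Real.exp (A * t₀))) fun t ht => ?_
    rcases le_total t₀ t with h | h
    · have h1 := hnonneg t h
      rw [hscrew t ht.le] at h1
      have : 0 ≤ |b| + S * Real.exp (A * t₀) := by positivity
      linarith
    · have h1 := neg_le_of_abs_le (hbound t)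
      have h3 : S * Real.exp (A * |t|) ≤ S * Real.exp (A * t₀) := by
        rw [abs_of_pos ht]
        gcongr
      have h4 : 0 ≤ (zeroMult D F 0 : ℝ) / 2 * t ^ 2 := by positivity
      linarith [neg_abs_le b]
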